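/- Let $X$ be a real Banach space admitting a $C^1$ Lipschitz bump function (a $C^1$, Lipschitz function $b:X\to\mathbb R$ whose closed support is bounded and non-empty). Let $M$ be a connected, paracompact, Hausdorff $C^1$ manifold modeled on $X$ with a Finsler structure in the sense of Palais, i.e. a continuous map $TM\to[0,\infty)$, $(x,v)\mapsto\|v\|_x$, such that (P1) each $\|\cdot\|_x$ is a norm on $T_xM$ and, for every $C^1$ chart $\varphi:U\to X$ with $x\in U$, the norm $v\mapsto\|d\varphi^{-1}(\varphi(x))(v)\|_x$ is equivalent to the norm of $X$; (P2) for all $x_0\in M$, $\varepsilon>0$ and every $C^1$ chart $\varphi:U\to X$ with $x_0\in U$ there is an open neighborhood $W\subset U$ of $x_0$ such that $$\tfrac1{1+\varepsilon}\|d\varphi^{-1}(\varphi(x_0))(v)\|_{x_0}\le\|d\varphi^{-1}(\varphi(x))(v)\|_x\le(1+\varepsilon)\|d\varphi^{-1}(\varphi(x_0))(v)\|_{x_0}\quad(x\in W,\ v\in X).$$ Let $d(p,q)$ be the infimum of the lengths $\int_a^b\|c'(t)\|_{c(t)}\,dt$ of the piecewise $C^1$ paths $c:[a,b]\to M$ from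 $p$ to $q$, and assume that $(M,d)$ is complete. For $\Delta\in T_xM^*$ put $\|\Delta\|_x=\sup\{|\Delta(\xi)|:\|\xi\|_x=1\}$ (which is $0$ if $T_xM=\{0\}$). For $w:[0,\infty)\times M\to\mathbb R$, $t>0$ and $x\in M$, let $D^+w(t,x)$ (respectively $D^-w(t,x)$) be the set of the differentials $(\alpha,\Delta)=dg(t,x)\in\mathbb R\times T_xM^*$ of the $C^1$ functions $g:(0,\infty)\times M\to\mathbb R$ such that $w-g$ has a local maximum (respectively minimum) at $(t,x)$. For a continuous Hamiltonian $H:[0,\infty)\times M\times\mathbb R\to\mathbb R$ and a bounded continuous $h:M\to\mathbb R$, consider $$u_t+H(t,x,\|u_x\|_x)=0\quad(t>0),\qquad u(0,x)=h(x).\tag{E}$$ A function $w:[0,\infty)\times M\to\mathbb R$ is a viscosity subsolution of (E) if it is upper semicontinuous, $\alpha+H(t,x,\|\Delta\|_x)\le0$ for all $t>0$, $x\in M$ and $(\alpha,\Delta)\in D^+w(t,x)$, and $w(0,x)\le h(x)$ for all $x\in M$. It is a viscosity supersolution of (E) if it is lower semicontinuous, $\alpha+H(t,x,\|\Delta\|_x)\ge0$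 for all $t>0$, $x\in M$ and $(\alpha,\Delta)\in D^-w(t,x)$, and $w(0,x)\ge h(x)$ for all $x\in M$. The Hamiltonian $H$ satisfies condition (A) if there are $C\ge0$ and a continuous $\omega:[0,\infty)\times\mathbb R\times\mathbb R\to\mathbb R$ with $\omega(0,0,0)=0$ such that for all $t_1,t_2\ge0$, $x_1,x_2\in M$, $r_1,r_2\in\mathbb R$ $$|H(t_1,x_1,r_1)-H(t_2,x_2,r_2)|\le\omega\big(|t_1-t_2|,d(x_1,x_2),r_1-r_2\big)+C\max\{|r_1|,|r_2|\}\big(|t_1-t_2|+d(x_1,x_2)\big).$$ Let $H_1,H_2:[0,\infty)\times M\times\mathbb R\to\mathbb R$ be continuous Hamiltonians satisfying condition (A) with $H_1\le H_2$, and let $h_1,h_2:M\to\mathbb R$ be bounded and continuous with $h_2\le h_1$. Let $v$ be a viscosity supersolution of (E) with Hamiltonian $H_1$ and initial condition $h_1$, and let $u$ be a viscosity subsolution of (E) with Hamiltonian $H_2$ and initial condition $h_2$. Assume that $u$ and $v$ are bounded on $[0,T)\times M$ for every $T>0$, and that for every $(t,x)\in(0,\infty)\times M$ either $u$ or $v$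 is Lipschitz in a neighborhood of $(t,x)$ (for the distance $|t-s|+d(x,y)$). Then, as an inequality in $[-\infty,+\infty]$, $$\sup_{[0,\infty)\times M}(u-v)\le\sup_{[0,\infty)\times M\times\mathbb R}(H_2-H_1)+\sup_M(h_2-h_1).$$ -/

import Mathlib

open Set Filter Topology MeasureTheory
open scoped Manifold ENNReal

noncomputable section

/-- A Banach space has a `C¹` Lipschitz bump function: a `C¹`, Lipschitz real function whose
closed support is bounded and non-empty. -/
def HasC1LipschitzBump (X : Type*) [NormedAddCommGroup X] [NormedSpace ℝ X] : Prop :=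
  ∃ b : X → ℝ, ContDiff ℝ 1 b ∧ (∃ K, LipschitzWith K b) ∧
    Bornology.IsBounded (tsupport b) ∧ (tsupport b).Nonempty

section Finsler

variable {X : Type*} [NormedAddCommGroup X] [NormedSpace ℝ X]
  {M : Type*} [TopologicalSpace M] [ChartedSpace X M]

/-- For a chart `φ` at `x` and a vector `v` of the model space, the number
`‖dφ⁻¹(φ(x))(v)‖_x`, where `F x` is the norm `‖·‖_x` on the tangent space at `x`. -/
def chartNorm (F : ∀ x : M, TangentSpace 𝓘(ℝ, X) x → ℝ)
    (φ : OpenPartialHomeomorph M X) (x : M) (v : X) : ℝ :=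
  F x (mfderiv 𝓘(ℝ, X) 𝓘(ℝ, X) φ.symm (φ x) v)

/-- `F`, that is `(x, v) ↦ ‖v‖_x`, is a Finsler structure in the sense of Palais on the
`C¹` manifold `M` modeled on `X`. Charts are those of the maximal `C¹` atlas. -/
structure IsPalaisFinsler [IsManifold 𝓘(ℝ, X) 1 M]
    (F : ∀ x : M, TangentSpace 𝓘(ℝ, X) x → ℝ) : Prop where
  continuous : Continuous fun p : TangentBundle 𝓘(ℝ, X) M => F p.proj p.snd
  nonneg : ∀ x v, 0 ≤ F x v
  eq_zero : ∀ x v, F x v = 0 → v = 0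
  smul : ∀ x (c : ℝ) v, F x (c • v) = |c| * F x v
  add_le : ∀ x v w, F x (v + w) ≤ F x v + F x w
  equivalent : ∀ φ ∈ IsManifold.maximalAtlas 𝓘(ℝ, X) 1 M, ∀ x ∈ φ.source,
    ∃ K : ℝ, 1 ≤ K ∧ ∀ v : X, K⁻¹ * ‖v‖ ≤ chartNorm F φ x v ∧ chartNorm F φ x v ≤ K * ‖v‖
  palais : ∀ φ ∈ IsManifold.maximalAtlas 𝓘(ℝ, X) 1 M, ∀ x₀ ∈ φ.source, ∀ ε : ℝ, 0 < ε →
    ∃ W : Set M, IsOpen W ∧ x₀ ∈ W ∧ W ⊆ φ.source ∧ ∀ x ∈ W, ∀ v : X,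
      (1 + ε)⁻¹ * chartNorm F φ x₀ v ≤ chartNorm F φ x v ∧
        chartNorm F φ x v ≤ (1 + ε) * chartNorm F φ x₀ v

/-- The path `c : [a, b] → M` is piecewise `C¹`: there is a partition
`a = s 0 ≤ s 1 ≤ ⋯ ≤ s n = b` such that `c` is `C¹` on each closed interval
`[s i, s (i + 1)]`. (In particular `a ≤ b` and `c` is continuous on `[a, b]`.) -/
def IsPiecewiseC1Path (X : Type*) [NormedAddCommGroup X] [NormedSpace ℝ X]
    {M : Type*} [TopologicalSpace M] [ChartedSpace X M] (c : ℝ → M) (a b : ℝ) : Prop :=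
  ∃ (n : ℕ) (s : ℕ → ℝ), Monotone s ∧ s 0 = a ∧ s n = b ∧
    ∀ i < n, ContMDiffOn 𝓘(ℝ, ℝ) 𝓘(ℝ, X) 1 c (Icc (s i) (s (i + 1)))

/-- The length `∫ₐᵇ ‖c'(t)‖_{c(t)} dt`. The finitely many points at which a piecewise `C¹` path
is not differentiable do not matter for the integral. -/
def finslerLength (F : ∀ x : M, TangentSpace 𝓘(ℝ, X) x → ℝ) (c : ℝ → M) (a b : ℝ) : ℝ≥0∞ :=
  ∫⁻ t in Icc a b, ENNReal.ofReal (F (c t) (mfderiv 𝓘(ℝ, ℝ) 𝓘(ℝ, X) c t (1 : ℝ)))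

/-- The Finsler distance of `p` and `q`, the infimum of the lengths of the piecewise `C¹` paths
from `p` to `q`. It is finite on a connected Finsler manifold. -/
def finslerDist (F : ∀ x : M, TangentSpace 𝓘(ℝ, X) x → ℝ) (p q : M) : ℝ :=
  (sInf {L : ℝ≥0∞ | ∃ (a b : ℝ) (c : ℝ → M), IsPiecewiseC1Path X c a b ∧ c a = p ∧ c b = q ∧
    L = finslerLength F c a b}).toReal

/-- `M` is complete for the Finsler distance: every Cauchy sequence converges. -/
def IsFinslerComplete (F : ∀ x : M, TangentSpace 𝓘(ℝ, X) x → ℝ) : Prop :=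
  ∀ s : ℕ → M, (∀ ε : ℝ, 0 < ε → ∃ N, ∀ m ≥ N, ∀ n ≥ N, finslerDist F (s m) (s n) < ε) →
    ∃ x, Tendsto (fun n => finslerDist F (s n) x) atTop (𝓝 0)

/-- The dual norm of a covector at `x`: the supremum of `|Δ ξ|` over `‖ξ‖_x = 1`
(equal to `0` when the tangent space is trivial). -/
def finslerDualNorm (F : ∀ x : M, TangentSpace 𝓘(ℝ, X) x → ℝ) (x : M)
    (Δ : TangentSpace 𝓘(ℝ, X) x →L[ℝ] ℝ) : ℝ :=
  sSup {r : ℝ | ∃ ξ, F x ξ = 1 ∧ r = |Δ ξ|}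

end Finsler

section Subdifferentials

variable {E : Type*} [NormedAddCommGroup E] [NormedSpace ℝ E]
  {B : Type*} [TopologicalSpace B] (I : ModelWithCorners ℝ E B)
  {N : Type*} [TopologicalSpace N] [ChartedSpace B N]

/-- The subdifferential `D⁻f(x)` of `f` at a point `x` of the open submanifold `Ω` of `N`:
the differentials at `x` of the `C¹` functions `g : Ω → ℝ` such that `f - g` has a local minimum
at `x`. -/
def subdifferential (Ω : Set N) (f : N → ℝ) (x : N) : Set (TangentSpace I x →L[ℝ] ℝ) :=
  {Δ | ∃ g : N → ℝ, ContMDiffOn I 𝓘(ℝ, ℝ) 1 g Ω ∧ IsLocalMin (fun y => f y - g y) x ∧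
    Δ = mvfderiv I g x}

/-- The superdifferential `D⁺f(x)`, with local maxima in place of local minima. -/
def superdifferential (Ω : Set N) (f : N → ℝ) (x : N) : Set (TangentSpace I x →L[ℝ] ℝ) :=
  {Δ | ∃ g : N → ℝ, ContMDiffOn I 𝓘(ℝ, ℝ) 1 g Ω ∧ IsLocalMax (fun y => f y - g y) x ∧
    Δ = mvfderiv I g x}

end Subdifferentials

section Evolution

variable {X : Type*} [NormedAddCommGroup X] [NormedSpace ℝ X]
  {M : Type*} [TopologicalSpace M] [ChartedSpace X M]

/-- The time component `α` of a covector `(α, Δ)` of `ℝ × M` at `(t, x)`. -/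
def timePart {t : ℝ} {x : M}
    (Φ : TangentSpace (𝓘(ℝ, ℝ).prod 𝓘(ℝ, X)) ((t, x) : ℝ × M) →L[ℝ] ℝ) : ℝ :=
  Φ ((1, 0) : ℝ × X)

/-- The space component `Δ` of a covector `(α, Δ)` of `ℝ × M` at `(t, x)`. -/
def spacePart {t : ℝ} {x : M}
    (Φ : TangentSpace (𝓘(ℝ, ℝ).prod 𝓘(ℝ, X)) ((t, x) : ℝ × M) →L[ℝ] ℝ) :
    TangentSpace 𝓘(ℝ, X) x →L[ℝ] ℝ :=
  ContinuousLinearMap.comp (M₂ := ℝ × X) Φ (ContinuousLinearMap.inr ℝ ℝ X)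

/-- Functions on `[0, ∞) × M` and `[0, ∞) × M × ℝ` are written as functions of a real time;
only their values at times `t ≥ 0` are ever used.

`u` is a viscosity subsolution of `u_t + H(t, x, ‖u_x‖_x) = 0` for `t > 0`, `u(0, x) = h(x)`. -/
structure IsViscositySubsolution (F : ∀ x : M, TangentSpace 𝓘(ℝ, X) x → ℝ)
    (H : ℝ → M → ℝ → ℝ) (h : M → ℝ) (u : ℝ × M → ℝ) : Prop where
  usc : UpperSemicontinuousOn u (Ici 0 ×ˢ univ)
  ineq : ∀ t : ℝ, 0 < t → ∀ x : M,
    ∀ Φ ∈ superdifferential (𝓘(ℝ, ℝ).prod 𝓘(ℝ, X)) (Ioi 0 ×ˢ univ) u (t, x),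
      timePart Φ + H t x (finslerDualNorm F x (spacePart Φ)) ≤ 0
  initial : ∀ x, u (0, x) ≤ h x

/-- `u` is a viscosity supersolution of `u_t + H(t, x, ‖u_x‖_x) = 0` for `t > 0`,
`u(0, x) = h(x)`. -/
structure IsViscositySupersolution (F : ∀ x : M, TangentSpace 𝓘(ℝ, X) x → ℝ)
    (H : ℝ → M → ℝ → ℝ) (h : M → ℝ) (u : ℝ × M → ℝ) : Prop where
  lsc : LowerSemicontinuousOn u (Ici 0 ×ˢ univ)
  ineq : ∀ t : ℝ, 0 < t → ∀ x : M,
    ∀ Φ ∈ subdifferential (𝓘(ℝ, ℝ).prod 𝓘(ℝ, X)) (Ioi 0 ×ˢ univ) u (t, x),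
      0 ≤ timePart Φ + H t x (finslerDualNorm F x (spacePart Φ))
  initial : ∀ x, h x ≤ u (0, x)

/-- `H` is continuous on `[0, ∞) × M × ℝ`. -/
def IsContinuousHamiltonian (H : ℝ → M → ℝ → ℝ) : Prop :=
  ContinuousOn (fun p : ℝ × M × ℝ => H p.1 p.2.1 p.2.2) (Ici 0 ×ˢ univ)

/-- Condition (A) for the Hamiltonian `H`, with constant `C` and modulus `m`. -/
def ConditionA (F : ∀ x : M, TangentSpace 𝓘(ℝ, X) x → ℝ) (H : ℝ → M → ℝ → ℝ) : Prop :=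
  ∃ (C : ℝ) (m : ℝ × ℝ × ℝ → ℝ), 0 ≤ C ∧ ContinuousOn m (Ici 0 ×ˢ univ) ∧ m (0, 0, 0) = 0 ∧
    ∀ t₁ t₂ : ℝ, 0 ≤ t₁ → 0 ≤ t₂ → ∀ (x₁ x₂ : M) (r₁ r₂ : ℝ),
      |H t₁ x₁ r₁ - H t₂ x₂ r₂| ≤ m (|t₁ - t₂|, finslerDist F x₁ x₂, r₁ - r₂)
        + C * max |r₁| |r₂| * (|t₁ - t₂| + finslerDist F x₁ x₂)

/-- `u` is bounded on `[0, T) × M` for every `T > 0`. -/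
def IsBoundedOnStrips (u : ℝ × M → ℝ) : Prop :=
  ∀ T : ℝ, 0 < T → ∃ K : ℝ, ∀ t : ℝ, 0 ≤ t → t < T → ∀ x, |u (t, x)| ≤ K

/-- `u` is Lipschitz in a neighborhood of `p`, for the distance `|t - s| + d(x, y)`. -/
def IsLipschitzNear (F : ∀ x : M, TangentSpace 𝓘(ℝ, X) x → ℝ) (u : ℝ × M → ℝ)
    (p : ℝ × M) : Prop :=
  ∃ W ∈ 𝓝 p, ∃ K : ℝ, ∀ q ∈ W, ∀ q' ∈ W,
    |u q - u q'| ≤ K * (|q.1 - q'.1| + finslerDist F q.2 q'.2)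

end Evolution

end

/-! Since `H₁ ≤ H₂`, the supremum of `H₂ - H₁` is nonnegative, so it suffices to prove `u - v ≤ μ`
for every real `μ` bounding `h₂ - h₁`. Suppose this fails at `(t, x)`. Adding to `v - u` a function
`Θ` of time with slope at least `lam > 0`, small at time `t` and huge at `2 * t`, keeps the low
values away from both ends of the strip `[0, 2t] × M`. The strip is complete, so Ekeland's principle
(`exists_ekeland_point_strip`) gives an interior point where `v - u + Θ` is minimal up to a term `ε`
times the distance.

No smooth distance is available on `M`, so variables are not doubled globally. Instead the point is
viewed in a chart, where `v + (-u) + ε * distance + Θ` has a local minimum on the Banach space `ℝ ×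
X`. The fuzzy sum rule `exists_isViscositySubgradient_add_add`, which rests on the smooth
variational principle `exists_contDiff_add_min` and hence on the bump function, yields subgradients
`p₁` of `v` and `p₂` of `-u` at nearby points, with `p₁ + p₂` equal to `-Θ'` up to a multiple of `ε`
and a small error.

Three facts let the two viscosity inequalities be compared (`exists_viscosity_pair`). One of `u`,
`v` is locally Lipschitz, so `p₁` and `p₂` are bounded independently of how close the points are,
and the term of condition (A) that multiplies covector size by distance is negligible. By Palais'
condition the dual norms at nearby points almost agree. Finally, `ε` is fixed before the Ekeland
point and its chart are known, so the slope of the perturbation must be measured in the Finsler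
norm, not in the norm of `X`. Subtracting the inequalities makes `lam` smaller than a sum of errors
that is below `lam` (`sub_le_of_initial_sub_le`). -/

/-! ### Normalized bump functions -/

/-- A `C¹` bump function with values in `[0, 1]`, equal to `1` at the origin, vanishing off the open
unit ball, and with derivative bounded by `K`. -/
structure IsNormalizedBump {E : Type*} [NormedAddCommGroup E] [NormedSpace ℝ E]
    (b : E → ℝ) (K : ℝ) : Prop where
  contDiff : ContDiff ℝ 1 b
  norm_fderiv_le : ∀ z, ‖fderiv ℝ b z‖ ≤ K
  nonneg : ∀ z, 0 ≤ b z
  le_one : ∀ z, b z ≤ 1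
  map_zero : b 0 = 1
  eq_zero : ∀ z, 1 ≤ ‖z‖ → b z = 0

section Bump

variable {E : Type*} [NormedAddCommGroup E] [NormedSpace ℝ E]
  {G : Type*} [NormedAddCommGroup G] [NormedSpace ℝ G]

theorem IsNormalizedBump.const_nonneg {b : E → ℝ} {K : ℝ} (hb : IsNormalizedBump b K) : 0 ≤ K :=
  (norm_nonneg _).trans (hb.norm_fderiv_le 0)

theorem IsNormalizedBump.contDiff_rescale {b : E → ℝ} {K : ℝ} (hb : IsNormalizedBump b K)
    (s : ℝ) (y : E) : ContDiff ℝ 1 fun z => b (s • (z - y)) :=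
  hb.contDiff.comp (by fun_prop)

theorem IsNormalizedBump.hasFDerivAt_rescale {b : E → ℝ} {K : ℝ} (hb : IsNormalizedBump b K)
    (s : ℝ) (y z : E) :
    HasFDerivAt (fun z => b (s • (z - y))) (s • fderiv ℝ b (s • (z - y))) z := by
  have h1 : HasFDerivAt (fun z : E => s • (z - y)) (s • ContinuousLinearMap.id ℝ E) z :=
    ((hasFDerivAt_id z).sub_const y).const_smul s
  have h2 := ((hb.contDiff.differentiable one_ne_zero) (s • (z - y))).hasFDerivAt.comp z h1
  refine h2.congr_fderiv ?_
  ext; simp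

theorem IsNormalizedBump.norm_fderiv_rescale_le {b : E → ℝ} {K : ℝ} (hb : IsNormalizedBump b K)
    {s : ℝ} (hs : 0 ≤ s) (y z : E) : ‖fderiv ℝ (fun z => b (s • (z - y))) z‖ ≤ s * K := by
  rw [(hb.hasFDerivAt_rescale s y z).fderiv, norm_smul, Real.norm_of_nonneg hs]
  exact mul_le_mul_of_nonneg_left (hb.norm_fderiv_le _) hs

/-- Rescaling around a point where the bump is nonzero gives a Lipschitz `l` with `l 0 = 1` that
vanishes off the unit ball. Composing with `r ↦ 4r²/(1+r²)²`, which maps `ℝ` into `[0, 1]`, fixes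
`0` and `1` and has bounded derivative, forces the range into `[0, 1]`. -/
theorem HasC1LipschitzBump.exists_isNormalizedBump (h : HasC1LipschitzBump E) :
    ∃ (b : E → ℝ) (K : ℝ), IsNormalizedBump b K := by
  obtain ⟨b, hb, ⟨K, hK⟩, hbdd, hne⟩ := h
  obtain ⟨a, ha⟩ : ∃ a, b a ≠ 0 := by
    by_contra! hzero
    obtain ⟨x, hx⟩ := hne
    have : b = 0 := funext hzero
    simp [this, tsupport] at hx
  obtain ⟨R, hR⟩ := hbdd.subset_ball a
  set s : ℝ := max R 1 with hs
  have hs0 : 0 < s := lt_of_lt_of_le one_pos (le_max_right _ _)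
  set l : E → ℝ := fun z => b (a + s • z) / b a with hl
  have hlC : ContDiff ℝ 1 l := by
    apply ContDiff.div_const
    exact hb.comp (by fun_prop)
  have hlL : ∀ z, ‖fderiv ℝ l z‖ ≤ K * s / |b a| := by
    intro z
    apply norm_fderiv_le_of_lip' ℝ (by positivity)
    refine Eventually.of_forall fun y => ?_
    have := hK.dist_le_mul (a + s • y) (a + s • z)
    rw [Real.dist_eq, dist_eq_norm, add_sub_add_left_eq_sub, ← smul_sub, norm_smul,
      Real.norm_of_nonneg hs0.le] at this
    simp only [hl, ← sub_div, norm_div, Real.norm_eq_abs]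
    rw [div_mul_eq_mul_div]
    gcongr
    linarith
  have hlv : ∀ z, 1 ≤ ‖z‖ → l z = 0 := by
    intro z hz
    have : a + s • z ∉ tsupport b := by
      intro hmem
      have := hR hmem
      rw [Metric.mem_ball, dist_eq_norm, add_sub_cancel_left, norm_smul,
        Real.norm_of_nonneg hs0.le] at this
      have h1 : R ≤ s := le_max_left _ _
      nlinarith
    simp [hl, image_eq_zero_of_notMem_tsupport this]
  have hl0 : l 0 = 1 := by simp [hl, ha]
  have hk : ∀ r : ℝ, HasDerivAt (fun r : ℝ => 4 * r ^ 2 / (1 + r ^ 2) ^ 2)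
      (8 * r * (1 - r ^ 2) / (1 + r ^ 2) ^ 3) r := by
    intro r
    have h1 : HasDerivAt (fun r : ℝ => 4 * r ^ 2) (4 * (2 * r)) r := by
      simpa using (hasDerivAt_pow 2 r).const_mul 4
    have h2 : HasDerivAt (fun r : ℝ => (1 + r ^ 2) ^ 2) (2 * (1 + r ^ 2) * (2 * r)) r := by
      simpa using ((hasDerivAt_pow 2 r).const_add 1).fun_pow 2
    have h3 : (1 + r ^ 2) ≠ 0 := by positivity
    refine (h1.fun_div h2 (pow_ne_zero 2 h3)).congr_deriv ?_
    field_simp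
    ring
  have hkb : ∀ r : ℝ, |8 * r * (1 - r ^ 2) / (1 + r ^ 2) ^ 3| ≤ 8 := by
    intro r
    rw [abs_div, abs_of_pos (by positivity : 0 < (1 + r ^ 2) ^ 3), div_le_iff₀ (by positivity)]
    rw [abs_le]
    constructor <;> nlinarith [sq_nonneg (r - 1), sq_nonneg (r + 1), sq_nonneg r,
      sq_nonneg (r ^ 2), sq_nonneg (r ^ 2 - r), sq_nonneg (r ^ 2 + r), sq_nonneg (r ^ 3)]
  refine ⟨fun z => 4 * l z ^ 2 / (1 + l z ^ 2) ^ 2, 8 * (K * s / |b a|), ?_, ?_, ?_, ?_, ?_, ?_⟩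
  · exact ((hlC.pow 2).const_smul (4 : ℝ)).div ((contDiff_const.add (hlC.pow 2)).pow 2)
      fun z => by positivity
  · intro z
    have := (hk (l z)).comp_hasFDerivAt z ((hlC.differentiable one_ne_zero) z).hasFDerivAt
    rw [show (fun z => 4 * l z ^ 2 / (1 + l z ^ 2) ^ 2)
      = (fun r : ℝ => 4 * r ^ 2 / (1 + r ^ 2) ^ 2) ∘ l from rfl, this.fderiv, norm_smul]
    exact mul_le_mul (hkb _) (hlL z) (norm_nonneg _) (by norm_num)
  · intro z; positivity
  · intro z
    rw [div_le_one (by positivity)]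
    nlinarith [sq_nonneg (1 - l z ^ 2)]
  · norm_num [hl0]
  · intro z hz; simp [hlv z hz]

/-- For the sup norm, a vector of norm at least `1` has a coordinate of norm at least `1`, so one
factor vanishes there. This provides bumps on `ℝ × X` and on the doubled space `E × E`. -/
theorem IsNormalizedBump.prod {b : E → ℝ} {K : ℝ} (hb : IsNormalizedBump b K)
    {b' : G → ℝ} {K' : ℝ} (hb' : IsNormalizedBump b' K') :
    IsNormalizedBump (fun z : E × G => b z.1 * b' z.2) (K + K') := by
  refine ⟨(hb.contDiff.comp contDiff_fst).mul (hb'.contDiff.comp contDiff_snd), ?_, ?_, ?_, ?_, ?_⟩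
  · intro z
    have h1 : HasFDerivAt (fun z : E × G => b z.1) _ z :=
      ((hb.contDiff.differentiable one_ne_zero) z.1).hasFDerivAt.comp z hasFDerivAt_fst
    have h2 : HasFDerivAt (fun z : E × G => b' z.2) _ z :=
      ((hb'.contDiff.differentiable one_ne_zero) z.2).hasFDerivAt.comp z hasFDerivAt_snd
    rw [(h1.fun_mul h2).fderiv]
    have n1 : ‖fderiv ℝ b z.1 ∘L ContinuousLinearMap.fst ℝ E G‖ ≤ K := by
      refine (ContinuousLinearMap.opNorm_comp_le _ _).trans ?_
      have := mul_le_mul (hb.norm_fderiv_le z.1) (ContinuousLinearMap.norm_fst_le ℝ E G)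
        (norm_nonneg _) hb.const_nonneg
      simpa using this
    have n2 : ‖fderiv ℝ b' z.2 ∘L ContinuousLinearMap.snd ℝ E G‖ ≤ K' := by
      refine (ContinuousLinearMap.opNorm_comp_le _ _).trans ?_
      have := mul_le_mul (hb'.norm_fderiv_le z.2) (ContinuousLinearMap.norm_snd_le ℝ E G)
        (norm_nonneg _) hb'.const_nonneg
      simpa using this
    refine (norm_add_le _ _).trans ?_
    rw [norm_smul, norm_smul, Real.norm_of_nonneg (hb.nonneg _), Real.norm_of_nonneg (hb'.nonneg _)]
    nlinarith [hb.nonneg z.1, hb.le_one z.1, hb'.nonneg z.2, hb'.le_one z.2, hb.const_nonneg,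
      hb'.const_nonneg, mul_le_mul (hb.le_one z.1) n2 (norm_nonneg _) zero_le_one,
      mul_le_mul (hb'.le_one z.2) n1 (norm_nonneg _) zero_le_one]
  · intro z; exact mul_nonneg (hb.nonneg _) (hb'.nonneg _)
  · intro z; exact mul_le_one₀ (hb.le_one _) (hb'.nonneg _) (hb'.le_one _)
  · simp [hb.map_zero, hb'.map_zero]
  · intro z hz
    rcases le_max_iff.1 (Prod.norm_def z ▸ hz) with h | h
    · simp [hb.eq_zero _ h]
    · simp [hb'.eq_zero _ h]

theorem exists_isNormalizedBump_real : ∃ (b : ℝ → ℝ) (K : ℝ), IsNormalizedBump b K := by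
  apply HasC1LipschitzBump.exists_isNormalizedBump
  let f : ContDiffBump (0 : ℝ) := ⟨1, 2, one_pos, one_lt_two⟩
  have hf : ContDiff ℝ 1 f := f.contDiff
  obtain ⟨C, hC⟩ := (hf.continuous_fderiv one_ne_zero).bounded_above_of_compact_support
    (f.hasCompactSupport.fderiv (𝕜 := ℝ))
  refine ⟨f, hf, ⟨C.toNNReal, lipschitzWith_of_nnnorm_fderiv_le (hf.differentiable one_ne_zero)
    fun x => ?_⟩, f.hasCompactSupport.isBounded, ⟨0, subset_tsupport _ ?_⟩⟩
  · rw [← NNReal.coe_le_coe, coe_nnnorm]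
    exact (hC x).trans (Real.le_coe_toNNReal C)
  · rw [Function.mem_support, f.one_of_mem_closedBall (Metric.mem_closedBall_self (by norm_num))]
    exact one_ne_zero

end Bump

/-! ### The smooth variational principle of Deville, Godefroy and Zizler -/

section VariationalPrinciple

variable {E : Type*} [NormedAddCommGroup E] [NormedSpace ℝ E]

/-- Zooming by `2 ^ n` multiplies the derivative by `2 ^ n`; the weight `4⁻ⁿ` still leaves a
geometric series, so the sum is `C¹`. -/
theorem exists_contDiff_tsum_rescale {b : E → ℝ} {K : ℝ} (hb : IsNormalizedBump b K)
    {c : ℝ} (hc : 0 < c) (y : ℕ → E) :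
    ∃ g : E → ℝ, ContDiff ℝ 1 g ∧ (∀ z, |g z| ≤ 2 * c) ∧ (∀ z, ‖fderiv ℝ g z‖ ≤ 2 * (c * K)) ∧
      ∀ z, HasSum (fun n : ℕ => c * (1 / 4) ^ n * b ((2 : ℝ) ^ n • (z - y n))) (g z) := by
  set β : ℕ → E → ℝ := fun n z => c * (1 / 4) ^ n * b ((2 : ℝ) ^ n • (z - y n)) with hβ
  have hβC : ∀ n, ContDiff ℝ 1 (β n) := fun n => contDiff_const.mul (hb.contDiff_rescale _ _)
  have hβd : ∀ n, Differentiable ℝ (β n) := fun n => (hβC n).differentiable one_ne_zero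
  have hK := hb.const_nonneg
  have hβn : ∀ n z, ‖β n z‖ ≤ c * (1 / 4) ^ n := by
    intro n z
    simp only [hβ, norm_mul, Real.norm_of_nonneg (hb.nonneg _), Real.norm_of_nonneg hc.le,
      norm_pow, Real.norm_of_nonneg (by norm_num : (0 : ℝ) ≤ 1 / 4)]
    exact mul_le_of_le_one_right (by positivity) (hb.le_one _)
  have hβ' : ∀ n z, ‖fderiv ℝ (β n) z‖ ≤ c * K * (1 / 2) ^ n := by
    intro n z
    simp only [hβ]
    rw [fderiv_const_mul ((hb.contDiff_rescale _ _).differentiable one_ne_zero z), norm_smul,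
      Real.norm_of_nonneg (by positivity)]
    calc c * (1 / 4) ^ n * _ ≤ c * (1 / 4) ^ n * (2 ^ n * K) :=
          mul_le_mul_of_nonneg_left (hb.norm_fderiv_rescale_le (by positivity) _ _) (by positivity)
      _ = c * K * ((1 / 4) ^ n * 2 ^ n) := by ring
      _ = c * K * (1 / 2) ^ n := by rw [← mul_pow]; norm_num
  have s4 : HasSum (fun n : ℕ => c * (1 / 4 : ℝ) ^ n) (c * (1 - 1 / 4)⁻¹) :=
    (hasSum_geometric_of_lt_one (by norm_num) (by norm_num)).mul_left c
  have s2 : HasSum (fun n : ℕ => c * K * (1 / 2 : ℝ) ^ n) (2 * (c * K)) := by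
    simpa [mul_comm] using (hasSum_geometric_two).mul_left (c * K)
  have hsum : ∀ z, Summable fun n => β n z := fun z => s4.summable.of_norm_bounded (hβn · z)
  have hfd : ∀ z, HasFDerivAt (fun z => ∑' n, β n z) (∑' n, fderiv ℝ (β n) z) z := fun z =>
    hasFDerivAt_tsum s2.summable (fun n z => (hβd n z).hasFDerivAt) hβ' (hsum z) z
  refine ⟨fun z => ∑' n, β n z, ?_, ?_, ?_, fun z => (hsum z).hasSum⟩
  · rw [contDiff_one_iff_fderiv]
    refine ⟨fun z => (hfd z).differentiableAt, ?_⟩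
    rw [show fderiv ℝ (fun z => ∑' n, β n z) = fun z => ∑' n, fderiv ℝ (β n) z from
      funext fun z => (hfd z).fderiv]
    exact continuous_tsum (fun n => (hβC n).continuous_fderiv one_ne_zero) s2.summable hβ'
  · intro z
    refine (tsum_of_norm_bounded s4 (hβn · z)).trans ?_
    norm_num; linarith
  · intro z
    rw [(hfd z).fderiv]
    exact tsum_of_norm_bounded s2 (hβ' · z)

/-- On a Banach space with a `C¹` bump function with bounded derivative, a lower semicontinuous
function bounded below on a closed set attains its minimum there after a small `C¹`-small
perturbation. -/
theorem exists_contDiff_add_min [CompleteSpace E] {b : E → ℝ} {K : ℝ} (hb : IsNormalizedBump b K)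
    {S : Set E} (hS : IsClosed S) (hne : S.Nonempty) {f : E → ℝ} (hf : LowerSemicontinuousOn f S)
    {m : ℝ} (hm : ∀ y ∈ S, m ≤ f y) {κ : ℝ} (hκ : 0 < κ) :
    ∃ g : E → ℝ, ContDiff ℝ 1 g ∧ (∀ y, |g y| ≤ κ) ∧ (∀ y, ‖fderiv ℝ g y‖ ≤ κ) ∧
      ∃ y₀ ∈ S, ∀ y ∈ S, f y₀ + g y₀ ≤ f y + g y := by
  have hK := hb.const_nonneg
  -- The bump series has size at most `2c` and derivative at most `2cK`; this `c` makes both at most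
  -- `κ`.
  set c : ℝ := κ / (2 * (1 + K)) with hcdef
  have hc : 0 < c := by positivity
  have hcκ : 2 * c * (1 + K) = κ := by rw [hcdef]; field_simp
  -- At stage `n` a point is chosen that minimizes the current function up to half the height `c / 4
  -- ^ n` of the bump about to be subtracted there.
  have hpick : ∀ (F : {F : E → ℝ // ∃ m, ∀ y ∈ S, m ≤ F y}) (n : ℕ),
      ∃ y ∈ S, ∀ z ∈ S, F.1 y ≤ F.1 z + c * (1 / 4) ^ n / 2 := by
    rintro ⟨F, m, hF⟩ n
    have hbd : BddBelow (F '' S) := ⟨m, by rintro _ ⟨y, hy, rfl⟩; exact hF y hy⟩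
    obtain ⟨_, ⟨y, hy, rfl⟩, hlt⟩ := exists_lt_of_csInf_lt (hne.image F)
      (lt_add_of_pos_right (sInf (F '' S)) (by positivity : 0 < c * (1 / 4) ^ n / 2))
    refine ⟨y, hy, fun z hz => ?_⟩
    have := csInf_le hbd (mem_image_of_mem F hz)
    simp only
    linarith
  choose Y hYS hY using hpick
  let step : ℕ → {F : E → ℝ // ∃ m, ∀ y ∈ S, m ≤ F y} → {F : E → ℝ // ∃ m, ∀ y ∈ S, m ≤ F y} :=
    fun n F => ⟨fun z => F.1 z - c * (1 / 4) ^ n * b ((2 : ℝ) ^ n • (z - Y F n)), by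
      obtain ⟨m, hm⟩ := F.2
      refine ⟨m - c * (1 / 4) ^ n, fun y hy => ?_⟩
      have := mul_le_of_le_one_right (by positivity : 0 ≤ c * (1 / 4) ^ n)
        (hb.le_one ((2 : ℝ) ^ n • (y - Y F n)))
      linarith [hm y hy]⟩
  let Fs : ℕ → {F : E → ℝ // ∃ m, ∀ y ∈ S, m ≤ F y} := fun n => Nat.rec ⟨f, m, hm⟩ step n
  set y : ℕ → E := fun n => Y (Fs n) n with hy
  have hstep : ∀ n z, (Fs (n + 1)).1 z
      = (Fs n).1 z - c * (1 / 4) ^ n * b ((2 : ℝ) ^ n • (z - y n)) := fun n z => rfl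
  have hFs : ∀ n z, (Fs n).1 z
      = f z - ∑ k ∈ Finset.range n, c * (1 / 4) ^ k * b ((2 : ℝ) ^ k • (z - y k)) := by
    intro n z
    induction n with
    | zero => simp [Fs]
    | succ n ih => rw [hstep, ih, Finset.sum_range_succ]; ring
  -- If `y (n + 1)` were outside the `n`-th bump, its new value would be within `c / 4 ^ n / 2`
  -- below the old value at `y n`, whereas near-minimality puts it at least `7/8` of `c / 4 ^ n`
  -- below.
  have hdist : ∀ n, dist (y n) (y (n + 1)) ≤ 1 * (1 / 2) ^ n := by
    intro n
    by_contra! hlt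
    have hfar : b ((2 : ℝ) ^ n • (y (n + 1) - y n)) = 0 := by
      apply hb.eq_zero
      rw [norm_smul, norm_pow, Real.norm_of_nonneg zero_le_two, ← dist_eq_norm, dist_comm]
      calc (1 : ℝ) = 2 ^ n * (1 / 2) ^ n := by rw [← mul_pow]; norm_num
        _ ≤ _ := by rw [one_mul] at hlt; gcongr
    have h1 := hstep n (y (n + 1))
    rw [hfar, mul_zero, sub_zero] at h1
    have h2 := hstep n (y n)
    rw [sub_self, smul_zero, hb.map_zero, mul_one] at h2
    have h3 : (Fs (n + 1)).1 (y (n + 1)) ≤ (Fs (n + 1)).1 (y n) + c * (1 / 4) ^ (n + 1) / 2 :=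
      hY (Fs (n + 1)) (n + 1) (y n) (hYS _ _)
    have h4 : (Fs n).1 (y n) ≤ (Fs n).1 (y (n + 1)) + c * (1 / 4) ^ n / 2 :=
      hY (Fs n) n (y (n + 1)) (hYS _ _)
    have h5 : 0 < c * (1 / 4) ^ n := by positivity
    rw [pow_succ] at h3
    linarith
  obtain ⟨z₀, hz₀⟩ := cauchySeq_tendsto_of_complete
    (cauchySeq_of_le_geometric (1 / 2) 1 (by norm_num) hdist)
  have hz₀S : z₀ ∈ S := hS.mem_of_tendsto hz₀ (Eventually.of_forall fun n => hYS _ _)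
  obtain ⟨g, hgC, hgb, hgd, hgs⟩ := exists_contDiff_tsum_rescale hb hc y
  refine ⟨fun z => -g z, hgC.neg, fun z => ?_, fun z => ?_, z₀, hz₀S, fun z hz => ?_⟩
  · rw [abs_neg]; nlinarith [hgb z]
  · rw [fderiv_fun_neg, norm_neg]; nlinarith [hgd z]
  -- The terms are nonnegative, so the partial sum at the moving point `y n` is bounded by `g (y
  -- n)`. The limit then needs only continuity of `g` and pointwise convergence at `z`.
  · have hle : ∀ n, f (y n) ≤ f z + g (y n)
        - ∑ k ∈ Finset.range n, c * (1 / 4) ^ k * b ((2 : ℝ) ^ k • (z - y k))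
        + c * (1 / 4) ^ n / 2 := by
      intro n
      have h1 : (Fs n).1 (y n) ≤ (Fs n).1 z + c * (1 / 4) ^ n / 2 := hY (Fs n) n z hz
      rw [hFs, hFs] at h1
      have h2 := sum_le_hasSum (Finset.range n)
        (fun k _ => mul_nonneg (by positivity) (hb.nonneg _)) (hgs (y n))
      linarith
    have hlim : Tendsto (fun n => f z + g (y n)
        - ∑ k ∈ Finset.range n, c * (1 / 4) ^ k * b ((2 : ℝ) ^ k • (z - y k))
        + c * (1 / 4) ^ n / 2) atTop (𝓝 (f z + g z₀ - g z + c * 0 / 2)) := by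
      refine ((tendsto_const_nhds.add ((hgC.continuous.tendsto z₀).comp hz₀)).sub
        (hgs z).tendsto_sum_nat).add (((tendsto_pow_atTop_nhds_zero_of_lt_one (by norm_num)
          (by norm_num)).const_mul c).div_const 2)
    by_contra! hlt
    obtain ⟨q, hq1, hq2⟩ := exists_between (show f z + g z₀ - g z + c * 0 / 2 < f z₀ by linarith)
    have e1 := hlim.eventually_lt_const hq1
    have e2 : ∀ᶠ n in atTop, q < f (y n) :=
      (tendsto_nhdsWithin_iff.2 ⟨hz₀, Eventually.of_forall fun n => hYS _ _⟩).eventually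
        (hf z₀ hz₀S q hq2)
    obtain ⟨n, h1, h2⟩ := (e1.and e2).exists
    linarith [hle n]

end VariationalPrinciple

/-! ### The fuzzy sum rule -/

section FuzzySum

variable {E : Type*} [NormedAddCommGroup E] [NormedSpace ℝ E]

/-- `p` is the derivative at `z` of a `C¹` function `g` such that `f - g` has a local minimum
at `z`. -/
def IsViscositySubgradient (f : E → ℝ) (z : E) (p : E →L[ℝ] ℝ) : Prop :=
  ∃ g : E → ℝ, ContDiff ℝ 1 g ∧ IsLocalMin (fun y => f y - g y) z ∧ fderiv ℝ g z = p

/-- The increments of the test function lie below those of `f` near `z`, so a one-sided bound on the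
difference quotients of `f` passes to the derivative. -/
theorem IsViscositySubgradient.apply_le {f : E → ℝ} {z : E} {p : E →L[ℝ] ℝ}
    (hp : IsViscositySubgradient f z p) {v : E} {a : ℝ}
    (ha : ∀ᶠ s : ℝ in 𝓝[>] 0, f (z + s • v) - f z ≤ s * a) : p v ≤ a := by
  obtain ⟨g, hg, hmin, rfl⟩ := hp
  have hd : HasDerivAt (fun s : ℝ => g (z + s • v)) (fderiv ℝ g z v) 0 := by
    have h1 : HasDerivAt (fun s : ℝ => z + s • v) v 0 := by
      simpa using ((hasDerivAt_id (0 : ℝ)).smul_const v).const_add z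
    have h2 : HasFDerivAt g (fderiv ℝ g z) (z + (0 : ℝ) • v) := by
      simpa using ((hg.differentiable one_ne_zero) z).hasFDerivAt
    exact h2.comp_hasDerivAt 0 h1
  have hc : Tendsto (fun s : ℝ => z + s • v) (𝓝[>] 0) (𝓝 z) := by
    have : ContinuousAt (fun s : ℝ => z + s • v) 0 := by fun_prop
    simpa [ContinuousAt] using this.tendsto.mono_left (nhdsWithin_le_nhds (s := Ioi 0))
  have hslope : Tendsto (fun s : ℝ => s⁻¹ • (g (z + s • v) - g z)) (𝓝[>] 0)
      (𝓝 (fderiv ℝ g z v)) := by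
    simpa using hd.tendsto_slope_zero_right
  refine le_of_tendsto hslope ?_
  filter_upwards [ha, hc.eventually hmin, self_mem_nhdsWithin] with s h1 h2 h3
  rw [smul_eq_mul, inv_mul_le_iff₀ h3]
  linarith

theorem IsViscositySubgradient.norm_le {f : E → ℝ} {z : E} {p : E →L[ℝ] ℝ}
    (hp : IsViscositySubgradient f z p) {L : ℝ} (hL : 0 ≤ L)
    (hf : ∀ᶠ y in 𝓝 z, f y - f z ≤ L * ‖y - z‖) : ‖p‖ ≤ L := by
  have key : ∀ v, p v ≤ L * ‖v‖ := by
    intro v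
    refine hp.apply_le ?_
    have hc : Tendsto (fun s : ℝ => z + s • v) (𝓝[>] 0) (𝓝 z) := by
      have : ContinuousAt (fun s : ℝ => z + s • v) 0 := by fun_prop
      simpa [ContinuousAt] using this.tendsto.mono_left (nhdsWithin_le_nhds (s := Ioi 0))
    filter_upwards [hc.eventually hf, self_mem_nhdsWithin] with s h1 h2
    rw [add_sub_cancel_left, norm_smul, Real.norm_of_nonneg (le_of_lt h2)] at h1
    linarith
  refine p.opNorm_le_bound hL fun v => ?_
  rw [Real.norm_eq_abs, abs_le]
  refine ⟨?_, key v⟩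
  have := key (-v)
  rw [map_neg, norm_neg] at this
  linarith

/-- **Fuzzy sum rule.** If `f` is lower semicontinuous, `l` is Lipschitz, `φ` is `C¹` and
`f + l + φ` has a minimum over a ball at its center, then there are subgradients of `f` and `l` at
nearby points whose sum is close to `-φ'`. -/
theorem exists_isViscositySubgradient_add [CompleteSpace E] {b : E → ℝ} {K : ℝ}
    (hb : IsNormalizedBump b K) {f l φ : E → ℝ} {z₀ : E} {R L : ℝ} (hR : 0 < R) (hL : 0 ≤ L)
    (hf : LowerSemicontinuousOn f (Metric.closedBall z₀ R))
    (hl : ∀ z ∈ Metric.closedBall z₀ R, ∀ z' ∈ Metric.closedBall z₀ R,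
      |l z - l z'| ≤ L * ‖z - z'‖)
    (hφ : ContDiff ℝ 1 φ)
    (hmin : ∀ z ∈ Metric.closedBall z₀ R, f z₀ + l z₀ + φ z₀ ≤ f z + l z + φ z)
    {δ : ℝ} (hδ : 0 < δ) :
    ∃ z₁ ∈ Metric.ball z₀ δ, ∃ z₂ ∈ Metric.ball z₀ δ, ∃ p₁ p₂ : E →L[ℝ] ℝ,
      IsViscositySubgradient f z₁ p₁ ∧ IsViscositySubgradient l z₂ p₂ ∧
      ‖p₁ + p₂ + fderiv ℝ φ z₀‖ ≤ δ := by
  have hK := hb.const_nonneg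
  obtain ⟨r₁, hr₁, hφr⟩ := Metric.continuousAt_iff.1
    (hφ.continuous_fderiv one_ne_zero).continuousAt (δ / 4) (by positivity)
  set r : ℝ := min R (min (δ / 2) (r₁ / 2)) with hr
  have hr0 : 0 < r := by positivity
  have hrR : r ≤ R := min_le_left _ _
  have hrδ : r ≤ δ / 2 := (min_le_right _ _).trans (min_le_left _ _)
  have hrr : r ≤ r₁ / 2 := (min_le_right _ _).trans (min_le_right _ _)
  have hsub : Metric.closedBall z₀ r ⊆ Metric.closedBall z₀ R := Metric.closedBall_subset_closedBall hrR
  set ρ : ℝ := r / 2 with hρ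
  -- Depth of the well `-c * b (ρ⁻¹ • (z - z₀))` that forces the minimizer near `z₀`, chosen so that
  -- the derivative of the well is at most `δ / 4`.
  set c : ℝ := δ * ρ / (4 * (1 + K)) with hc
  have hc0 : 0 < c := by positivity
  have hcK : c * (ρ⁻¹ * K) ≤ δ / 4 := by
    rw [hc]
    have : ρ ≠ 0 := by positivity
    rw [show δ * ρ / (4 * (1 + K)) * (ρ⁻¹ * K) = δ / 4 * (K / (1 + K)) by field_simp]
    exact mul_le_of_le_one_right (by positivity) ((div_le_one (by positivity)).2 (by linarith))
  -- Height of the coupling term: separating the two variables within the ball gains at most `2 * L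
  -- * r` through `l`, so a full penalty loses at least `1`.
  set N : ℝ := 2 * L * r + 1 with hN
  have hN0 : 0 < N := by positivity
  -- With the variables `σ`-close, `l` changes by at most `c / 4`, too little to make up for leaving
  -- the well; and `ρ + σ ≤ r` keeps the second variable interior too.
  set σ : ℝ := min ρ (c / (4 * (L + 1))) with hσ
  have hσ0 : 0 < σ := by positivity
  have hσρ : σ ≤ ρ := min_le_left _ _
  have hσc : L * σ ≤ c / 4 := by
    have : σ ≤ c / (4 * (L + 1)) := min_le_right _ _
    rw [le_div_iff₀ (by positivity)] at this
    nlinarith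
  set A : E → ℝ := fun z => φ z - c * b (ρ⁻¹ • (z - z₀)) with hA
  have hAC : ContDiff ℝ 1 A := hφ.sub (contDiff_const.mul (hb.contDiff_rescale _ _))
  -- The variables of `f` and `l` are separated and coupled again by a bump penalty. The `- 0`
  -- matches the form of `contDiff_rescale` with center `0`.
  set Ψ : E × E → ℝ := fun z => A z.1 + N * (1 - b (σ⁻¹ • (z.1 - z.2 - 0))) with hΨ
  have hBC := hb.contDiff_rescale σ⁻¹ 0
  have hΨC : ContDiff ℝ 1 Ψ := (hAC.comp contDiff_fst).add
    (contDiff_const.mul (contDiff_const.sub (hBC.comp (contDiff_fst.sub contDiff_snd))))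
  set S : Set (E × E) := Metric.closedBall z₀ r ×ˢ Metric.closedBall z₀ r with hS
  have hSc : IsClosed S := Metric.isClosed_closedBall.prod Metric.isClosed_closedBall
  have hz₀ : z₀ ∈ Metric.closedBall z₀ r := Metric.mem_closedBall_self hr0.le
  set m₀ : ℝ := f z₀ + l z₀ + φ z₀ with hm₀
  have hlow : ∀ z ∈ S, m₀ - L * ‖z.1 - z.2‖ - c * b (ρ⁻¹ • (z.1 - z₀))
      + N * (1 - b (σ⁻¹ • (z.1 - z.2 - 0))) ≤ f z.1 + l z.2 + Ψ z := by
    rintro ⟨x, y⟩ ⟨hx, hy⟩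
    have h1 := hmin x (hsub hx)
    have h2 := (abs_le.1 (hl x (hsub hx) y (hsub hy))).2
    simp only [hΨ, hA]
    linarith
  have hnn : ∀ z ∈ S, ‖z.1 - z.2‖ ≤ 2 * r := by
    rintro ⟨x, y⟩ ⟨hx, hy⟩
    have h1 := dist_triangle_right x y z₀
    rw [dist_eq_norm] at h1
    have h2 : dist x z₀ ≤ r := hx
    have h3 : dist y z₀ ≤ r := hy
    change ‖x - y‖ ≤ 2 * r
    linarith
  have hlc : ContinuousOn l (Metric.closedBall z₀ R) := by
    have : LipschitzOnWith L.toNNReal l (Metric.closedBall z₀ R) :=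
      LipschitzOnWith.of_dist_le_mul fun x hx y hy => by
        rw [Real.dist_eq, dist_eq_norm, Real.coe_toNNReal _ hL]; exact hl x hx y hy
    exact this.continuousOn
  have hlsc : LowerSemicontinuousOn (fun z : E × E => f z.1 + l z.2 + Ψ z) S := by
    refine LowerSemicontinuousOn.add (LowerSemicontinuousOn.add ?_ ?_) ?_
    · exact hf.comp continuous_fst.continuousOn fun z hz => hsub hz.1
    · exact (hlc.comp continuous_snd.continuousOn fun z hz => hsub hz.2).lowerSemicontinuousOn
    · exact hΨC.continuous.continuousOn.lowerSemicontinuousOn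
  obtain ⟨g, hgC, hgb, hgd, ⟨z₁, z₂⟩, ⟨hz₁, hz₂⟩, hgm⟩ := exists_contDiff_add_min (hb.prod hb) hSc
    ⟨(z₀, z₀), hz₀, hz₀⟩ hlsc (m := m₀ - L * (2 * r) - c) (fun z hz => by
      have h1 := hlow z hz
      have h2 := mul_le_mul_of_nonneg_left (hnn z hz) hL
      have h3 := mul_le_of_le_one_right hc0.le (hb.le_one (ρ⁻¹ • (z.1 - z₀)))
      have h4 := mul_nonneg hN0.le (sub_nonneg.2 (hb.le_one (σ⁻¹ • (z.1 - z.2 - 0))))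
      linarith) (κ := min (min (δ / 8) (c / 8)) (1 / 4)) (by positivity)
  set κ : ℝ := min (min (δ / 8) (c / 8)) (1 / 4) with hκ
  have hκδ : κ ≤ δ / 8 := (min_le_left _ _).trans (min_le_left _ _)
  have hκc : κ ≤ c / 8 := (min_le_left _ _).trans (min_le_right _ _)
  have hκ1 : κ ≤ 1 / 4 := min_le_right _ _
  have hval : f z₁ + l z₂ + Ψ (z₁, z₂) ≤ m₀ - c + 2 * κ := by
    have h1 := hgm (z₀, z₀) ⟨hz₀, hz₀⟩
    have h2 : Ψ (z₀, z₀) = φ z₀ - c := by simp [hΨ, hA, hb.map_zero]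
    simp only [h2] at h1
    have h3 := (abs_le.1 (hgb (z₀, z₀))).2
    have h4 := (abs_le.1 (hgb (z₁, z₂))).1
    linarith
  have hlow' := hlow (z₁, z₂) ⟨hz₁, hz₂⟩
  have hn' : ‖z₁ - z₂‖ ≤ 2 * r := hnn (z₁, z₂) ⟨hz₁, hz₂⟩
  simp only at hlow'
  have hclose : ‖z₁ - z₂‖ < σ := by
    by_contra! hle
    have h1 : b (σ⁻¹ • (z₁ - z₂ - 0)) = 0 := by
      apply hb.eq_zero
      rw [sub_zero, norm_smul, Real.norm_of_nonneg (by positivity), inv_mul_eq_div]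
      exact (one_le_div hσ0).2 hle
    rw [h1] at hlow'
    have h2 := mul_le_mul_of_nonneg_left hn' hL
    have h3 := mul_le_of_le_one_right hc0.le (hb.le_one (ρ⁻¹ • (z₁ - z₀)))
    linarith
  have hin₁ : ‖z₁ - z₀‖ < ρ := by
    by_contra! hle
    have h1 : b (ρ⁻¹ • (z₁ - z₀)) = 0 := by
      apply hb.eq_zero
      rw [norm_smul, Real.norm_of_nonneg (by positivity), inv_mul_eq_div]
      exact (one_le_div (by positivity)).2 hle
    rw [h1] at hlow'
    have h2 := mul_le_mul_of_nonneg_left hclose.le hL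
    have h4 := mul_nonneg hN0.le (sub_nonneg.2 (hb.le_one (σ⁻¹ • (z₁ - z₂ - 0))))
    linarith
  have hin₂ : ‖z₂ - z₀‖ < r := by
    have := norm_sub_le (z₁ - z₀) (z₁ - z₂)
    rw [sub_sub_sub_cancel_left] at this
    linarith
  have hb₁ : z₁ ∈ Metric.ball z₀ r := by rw [Metric.mem_ball, dist_eq_norm]; linarith
  have hb₂ : z₂ ∈ Metric.ball z₀ r := by rw [Metric.mem_ball, dist_eq_norm]; exact hin₂
  have hrδ' : r < δ := by linarith
  have hTC : ContDiff ℝ 1 fun z => Ψ z + g z := hΨC.add hgC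
  have hAd := (hAC.differentiable one_ne_zero z₁).hasFDerivAt
  have hΨd : HasFDerivAt Ψ (fderiv ℝ A z₁ ∘L ContinuousLinearMap.fst ℝ E E +
      N • (-(fderiv ℝ (fun z => b (σ⁻¹ • (z - 0))) (z₁ - z₂) ∘L
        (ContinuousLinearMap.fst ℝ E E - ContinuousLinearMap.snd ℝ E E)))) (z₁, z₂) := by
    have h1 : HasFDerivAt (fun z : E × E => A z.1)
        (fderiv ℝ A z₁ ∘L ContinuousLinearMap.fst ℝ E E) (z₁, z₂) :=
      HasFDerivAt.comp (z₁, z₂) (f := Prod.fst) (g := A) hAd hasFDerivAt_fst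
    have h2 : HasFDerivAt (fun z : E × E => z.1 - z.2)
        (ContinuousLinearMap.fst ℝ E E - ContinuousLinearMap.snd ℝ E E) (z₁, z₂) :=
      hasFDerivAt_fst.sub hasFDerivAt_snd
    have h3 : HasFDerivAt (fun z : E × E => b (σ⁻¹ • (z.1 - z.2 - 0))) _ (z₁, z₂) :=
      HasFDerivAt.comp (z₁, z₂) (f := fun z : E × E => z.1 - z.2)
        (g := fun z => b (σ⁻¹ • (z - 0)))
        (hBC.differentiable one_ne_zero (z₁ - z₂)).hasFDerivAt h2
    exact h1.add ((h3.const_sub 1).const_mul N)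
  have hgd' := (hgC.differentiable one_ne_zero (z₁, z₂)).hasFDerivAt
  have hT := hΨd.add hgd'
  set T' := (fderiv ℝ A z₁ ∘L ContinuousLinearMap.fst ℝ E E +
      N • (-(fderiv ℝ (fun z => b (σ⁻¹ • (z - 0))) (z₁ - z₂) ∘L
        (ContinuousLinearMap.fst ℝ E E - ContinuousLinearMap.snd ℝ E E)))) +
        fderiv ℝ g (z₁, z₂) with hT'
  refine ⟨z₁, Metric.ball_subset_ball hrδ'.le hb₁, z₂, Metric.ball_subset_ball hrδ'.le hb₂,
    -(T' ∘L ContinuousLinearMap.inl ℝ E E), -(T' ∘L ContinuousLinearMap.inr ℝ E E),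
    ⟨fun x => -(Ψ (x, z₂) + g (x, z₂)), ?_, ?_, ?_⟩,
    ⟨fun y => -(Ψ (z₁, y) + g (z₁, y)), ?_, ?_, ?_⟩, ?_⟩
  · exact (hTC.comp (contDiff_id.prodMk contDiff_const)).neg
  · filter_upwards [Metric.isOpen_ball.mem_nhds hb₁] with x hx
    have := hgm (x, z₂) ⟨Metric.ball_subset_closedBall hx, hz₂⟩
    simp only at this
    linarith
  · exact (HasFDerivAt.comp z₁ (f := fun x => (x, z₂)) hT (hasFDerivAt_prodMk_left z₁ z₂)).neg.fderiv
  · exact (hTC.comp (contDiff_const.prodMk contDiff_id)).neg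
  · filter_upwards [Metric.isOpen_ball.mem_nhds hb₂] with y hy
    have := hgm (z₁, y) ⟨hz₁, Metric.ball_subset_closedBall hy⟩
    simp only at this
    linarith
  · exact (HasFDerivAt.comp z₂ (f := fun y => (z₁, y)) hT (hasFDerivAt_prodMk_right z₁ z₂)).neg.fderiv
  · have hA' : fderiv ℝ A z₁ = fderiv ℝ φ z₁ - c • fderiv ℝ (fun z => b (ρ⁻¹ • (z - z₀))) z₁ := by
      have h1 := (hφ.differentiable one_ne_zero z₁).hasFDerivAt
      have h2 := ((hb.contDiff_rescale ρ⁻¹ z₀).differentiable one_ne_zero z₁).hasFDerivAt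
      exact (h1.sub (h2.const_mul c)).fderiv
    have hbd := hb.norm_fderiv_rescale_le (by positivity : 0 ≤ ρ⁻¹) z₀ z₁
    set B' := fderiv ℝ (fun z => b (ρ⁻¹ • (z - z₀))) z₁ with hB'
    have hφ' : ‖fderiv ℝ φ z₁ - fderiv ℝ φ z₀‖ ≤ δ / 4 := by
      rw [← dist_eq_norm]
      refine (hφr ?_).le
      have : dist z₁ z₀ < r := hb₁
      linarith
    refine ContinuousLinearMap.opNorm_le_bound _ hδ.le fun v => ?_
    -- The sum of the two partial derivatives is the derivative along the diagonal, where the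
    -- coupling term is constant. The large constant `N / σ` therefore disappears.
    have hexp : (-(T' ∘L ContinuousLinearMap.inl ℝ E E) + -(T' ∘L ContinuousLinearMap.inr ℝ E E) +
        fderiv ℝ φ z₀) v = -((fderiv ℝ φ z₁ - fderiv ℝ φ z₀) v) + c * B' v
          - fderiv ℝ g (z₁, z₂) (v, v) := by
      have hsplit : T' (v, 0) + T' (0, v) = T' (v, v) := by rw [← map_add]; simp
      have hTv : T' (v, v) = fderiv ℝ φ z₁ v - c * B' v + fderiv ℝ g (z₁, z₂) (v, v) := by
        simp [hT', hA']
      simp only [add_apply, neg_apply, sub_apply, ContinuousLinearMap.comp_apply,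
        ContinuousLinearMap.inl_apply, ContinuousLinearMap.inr_apply]
      linarith
    rw [hexp]
    have e1 := (fderiv ℝ φ z₁ - fderiv ℝ φ z₀).le_of_opNorm_le hφ' v
    have e2 := B'.le_of_opNorm_le hbd v
    have e3 := (fderiv ℝ g (z₁, z₂)).le_of_opNorm_le ((hgd (z₁, z₂)).trans hκδ) (v, v)
    have e4 : ‖((v, v) : E × E)‖ = ‖v‖ := by simp [Prod.norm_def]
    rw [e4] at e3
    have e5 : ‖c * B' v‖ ≤ δ / 4 * ‖v‖ := by
      rw [norm_mul, Real.norm_of_nonneg hc0.le]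
      calc c * ‖B' v‖ ≤ c * (ρ⁻¹ * K * ‖v‖) := mul_le_mul_of_nonneg_left e2 hc0.le
        _ = c * (ρ⁻¹ * K) * ‖v‖ := by ring
        _ ≤ _ := mul_le_mul_of_nonneg_right hcK (norm_nonneg _)
    refine (norm_sub_le _ _).trans ((add_le_add_left (norm_add_le _ _) _).trans ?_)
    rw [norm_neg]
    have := norm_nonneg v
    nlinarith

end FuzzySum

/-! ### Ekeland's variational principle -/

/-- **Ekeland's variational principle**, for a space `Z` with a distance function `D`, under a
hypothesis that combines completeness and lower semicontinuity. -/
theorem exists_ekeland_point {Z : Type*} {D : Z → Z → ℝ} (hD0 : ∀ x y, 0 ≤ D x y)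
    (hself : ∀ x, D x x = 0)
    (hsymm : ∀ x y, D x y = D y x) (htri : ∀ x y z, D x z ≤ D x y + D y z)
    {G : Z → ℝ} {m : ℝ} (hm : ∀ z, m ≤ G z)
    (hG : ∀ s : ℕ → Z, (∀ ε : ℝ, 0 < ε → ∃ N, ∀ i ≥ N, ∀ j ≥ N, D (s i) (s j) < ε) →
      ∃ x, Tendsto (fun n => D (s n) x) atTop (𝓝 0) ∧ ∀ q < G x, ∀ᶠ n in atTop, q < G (s n))
    {ε : ℝ} (hε : 0 < ε) (a : Z) :
    ∃ z₀, G z₀ ≤ G a ∧ ∀ z, G z₀ ≤ G z + ε * D z z₀ := by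
  -- The successor of `z` is an admissible point whose value is at most halfway between the infimum
  -- over admissible points and `G z`. If that infimum equals `G z`, the point `z` itself serves.
  have hpick : ∀ z : Z, ∃ z', G z' + ε * D z z' ≤ G z ∧
      ∀ y, G y + ε * D z y ≤ G z → 2 * G z' - G z ≤ G y := by
    intro z
    set A : Set ℝ := G '' {y | G y + ε * D z y ≤ G z} with hA
    have hne : A.Nonempty := ⟨G z, z, by simp [hself], rfl⟩
    have hbd : BddBelow A := ⟨m, by rintro _ ⟨y, -, rfl⟩; exact hm y⟩
    have hle : sInf A ≤ G z := csInf_le hbd ⟨z, by simp [hself], rfl⟩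
    rcases hle.eq_or_lt with heq | hlt
    · refine ⟨z, by simp [hself], fun y hy => ?_⟩
      have := csInf_le hbd ⟨y, hy, rfl⟩
      linarith
    · obtain ⟨_, ⟨z', hz', rfl⟩, h'⟩ := exists_lt_of_csInf_lt hne
        (show sInf A < (sInf A + G z) / 2 by linarith)
      refine ⟨z', hz', fun y hy => ?_⟩
      have := csInf_le hbd ⟨y, hy, rfl⟩
      linarith
  choose nxt hn1 hn2 using hpick
  let s : ℕ → Z := fun n => Nat.rec a (fun _ z => nxt z) n
  have hs : ∀ n, s (n + 1) = nxt (s n) := fun n => rfl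
  have hchain : ∀ n k, G (s (n + k)) + ε * D (s n) (s (n + k)) ≤ G (s n) := by
    intro n k
    induction k with
    | zero => simp [hself]
    | succ k ih =>
      have h1 := hn1 (s (n + k))
      rw [← hs] at h1
      have h2 := mul_le_mul_of_nonneg_left (htri (s n) (s (n + k)) (s (n + k + 1))) hε.le
      rw [← add_assoc]
      linarith
  have hanti : Antitone fun n => G (s n) := antitone_nat_of_succ_le fun n => by
    have := hchain n 1
    nlinarith [hD0 (s n) (s (n + 1))]
  obtain ⟨g, hg⟩ : ∃ g, Tendsto (fun n => G (s n)) atTop (𝓝 g) :=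
    ⟨_, tendsto_atTop_ciInf hanti ⟨m, by rintro _ ⟨n, rfl⟩; exact hm _⟩⟩
  have hgle : ∀ n, g ≤ G (s n) := fun n => hanti.le_of_tendsto hg n
  obtain ⟨z₀, hz₀, hlsc⟩ := hG s (by
    intro η hη
    obtain ⟨N, hN⟩ := (hg.eventually_lt_const (show g < g + ε * η by nlinarith)).exists
    have key : ∀ i ≥ N, ∀ j ≥ i, D (s i) (s j) < η := by
      intro i hi j hj
      obtain ⟨k, rfl⟩ := Nat.exists_eq_add_of_le hj
      have h1 := hchain i k
      have h2 := hgle (i + k)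
      have h3 : G (s i) ≤ G (s N) := hanti hi
      have h4 : ε * D (s i) (s (i + k)) < ε * η := by linarith
      exact lt_of_mul_lt_mul_left h4 hε.le
    refine ⟨N, fun i hi j hj => ?_⟩
    rcases le_total i j with h | h
    · exact key i hi j h
    · rw [hsymm]; exact key j hj i h)
  have hz₀g : G z₀ ≤ g := by
    by_contra! hlt
    obtain ⟨q, hq1, hq2⟩ := exists_between hlt
    obtain ⟨n, h1, h2⟩ := ((hlsc q hq2).and (hg.eventually_lt_const hq1)).exists
    linarith
  have hmem : ∀ n, G z₀ + ε * D (s n) z₀ ≤ G (s n) := by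
    intro n
    have hlim : Tendsto (fun k => G (s n) - g + ε * D (s k) z₀) atTop (𝓝 (G (s n) - g + ε * 0)) :=
      (hz₀.const_mul ε).const_add _
    have : ε * D (s n) z₀ ≤ G (s n) - g + ε * 0 := by
      refine ge_of_tendsto hlim ?_
      filter_upwards [eventually_ge_atTop n] with k hk
      obtain ⟨j, rfl⟩ := Nat.exists_eq_add_of_le hk
      have h1 := hchain n j
      have h2 := mul_le_mul_of_nonneg_left (htri (s n) (s (n + j)) z₀) hε.le
      have h3 := hgle (n + j)
      linarith
    linarith
  refine ⟨z₀, ?_, fun z => ?_⟩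
  · have := hmem 0
    have h0 : s 0 = a := rfl
    rw [h0] at this
    nlinarith [hD0 a z₀]
  -- A point violating the conclusion is admissible from every `s n`, so the halfway property bounds
  -- the limit of the values by `G z`, which is below `G z₀`.
  · by_contra! hlt
    have h1 : ∀ n, 2 * G (s (n + 1)) - G (s n) ≤ G z := by
      intro n
      refine hn2 (s n) z ?_
      have h2 := mul_le_mul_of_nonneg_left (htri (s n) z₀ z) hε.le
      rw [hsymm z₀ z] at h2
      linarith [hmem n]
    have h2 : Tendsto (fun n => 2 * G (s (n + 1)) - G (s n)) atTop (𝓝 (2 * g - g)) :=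
      ((hg.comp (tendsto_add_atTop_nat 1)).const_mul 2).sub hg
    have h3 := le_of_tendsto' h2 h1
    nlinarith [hD0 z z₀]

/-! ### The fuzzy sum rule with two semicontinuous terms and bounded covectors -/

section FuzzySumThree

variable {E : Type*} [NormedAddCommGroup E] [NormedSpace ℝ E]

theorem IsViscositySubgradient.norm_le_of_abs_sub_le {f : E → ℝ} {z₀ z : E} {p : E →L[ℝ] ℝ}
    (hp : IsViscositySubgradient f z p) {R L : ℝ} (hL : 0 ≤ L)
    (hf : ∀ y ∈ Metric.closedBall z₀ R, ∀ y' ∈ Metric.closedBall z₀ R, |f y - f y'| ≤ L * ‖y - y'‖)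
    (hz : z ∈ Metric.ball z₀ R) : ‖p‖ ≤ L := by
  refine hp.norm_le hL ?_
  filter_upwards [Metric.isOpen_ball.mem_nhds hz] with y hy
  exact (le_abs_self _).trans (hf y (Metric.ball_subset_closedBall hy) z
    (Metric.ball_subset_closedBall hz))

/-- Splitting a subgradient of `f + l`, where `l` is Lipschitz. -/
theorem IsViscositySubgradient.exists_add [CompleteSpace E] {b : E → ℝ} {K : ℝ}
    (hb : IsNormalizedBump b K) {f l : E → ℝ} {z₀ z₁ : E} {R L : ℝ} (hL : 0 ≤ L)
    (hf : LowerSemicontinuousOn f (Metric.closedBall z₀ R))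
    (hl : ∀ z ∈ Metric.closedBall z₀ R, ∀ z' ∈ Metric.closedBall z₀ R, |l z - l z'| ≤ L * ‖z - z'‖)
    (hz₁ : z₁ ∈ Metric.ball z₀ R) {p : E →L[ℝ] ℝ}
    (hp : IsViscositySubgradient (fun z => f z + l z) z₁ p) {δ : ℝ} (hδ : 0 < δ) :
    ∃ z₂ ∈ Metric.ball z₁ δ, ∃ z₃ ∈ Metric.ball z₁ δ, ∃ p₂ p₃ : E →L[ℝ] ℝ,
      IsViscositySubgradient f z₂ p₂ ∧ IsViscositySubgradient l z₃ p₃ ∧ ‖p₂ + p₃ - p‖ ≤ δ ∧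
      ‖p₂‖ ≤ L + ‖p‖ + δ ∧ ‖p₃‖ ≤ L + ‖p‖ + δ := by
  obtain ⟨g, hg, hmin, rfl⟩ := hp
  obtain ⟨r, hr, hball⟩ := Metric.nhds_basis_closedBall.mem_iff.1
    (inter_mem (Metric.isOpen_ball.mem_nhds hz₁) hmin)
  have hsub : Metric.closedBall z₁ r ⊆ Metric.closedBall z₀ R := fun z hz =>
    Metric.ball_subset_closedBall (hball hz).1
  obtain ⟨z₂, hz₂, z₃, hz₃, p₂, p₃, h₂, h₃, hle⟩ := exists_isViscositySubgradient_add hb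
    (φ := fun z => -g z) hr hL (hf.mono hsub) (fun z hz z' hz' => hl z (hsub hz) z' (hsub hz'))
    hg.neg (fun z hz => by
      have := (hball hz).2
      simp only [mem_ofPred_eq] at this
      linarith) (show 0 < min δ r by positivity)
  rw [fderiv_fun_neg, ← sub_eq_add_neg] at hle
  have hn₃ : ‖p₃‖ ≤ L := h₃.norm_le_of_abs_sub_le hL hl
    (hball (Metric.ball_subset_closedBall (Metric.ball_subset_ball (min_le_right _ _) hz₃))).1
  have hle' := hle.trans (min_le_left _ _)
  refine ⟨z₂, Metric.ball_subset_ball (min_le_left _ _) hz₂, z₃,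
    Metric.ball_subset_ball (min_le_left _ _) hz₃, p₂, p₃, h₂, h₃, hle', ?_, ?_⟩
  · have : p₂ = (p₂ + p₃ - fderiv ℝ g z₁) + fderiv ℝ g z₁ - p₃ := by abel
    rw [this]
    refine (norm_sub_le _ _).trans ?_
    have := norm_add_le (p₂ + p₃ - fderiv ℝ g z₁) (fderiv ℝ g z₁)
    linarith
  · linarith [norm_nonneg (fderiv ℝ g z₁)]

/-- A fuzzy sum rule for `f₁ + f₂ + l + φ` with `f₁`, `f₂` lower semicontinuous and one of them
Lipschitz, `l` Lipschitz and `φ` of class `C¹`. -/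
theorem exists_isViscositySubgradient_add_add [CompleteSpace E] {b : E → ℝ} {K : ℝ}
    (hb : IsNormalizedBump b K) {f₁ f₂ l φ : E → ℝ} {z₀ : E} {R L L' : ℝ} (hR : 0 < R)
    (hL : 0 ≤ L) (hL' : 0 ≤ L')
    (hf₁ : LowerSemicontinuousOn f₁ (Metric.closedBall z₀ R))
    (hf₂ : LowerSemicontinuousOn f₂ (Metric.closedBall z₀ R))
    (hf : (∀ z ∈ Metric.closedBall z₀ R, ∀ z' ∈ Metric.closedBall z₀ R,
        |f₁ z - f₁ z'| ≤ L * ‖z - z'‖) ∨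
      ∀ z ∈ Metric.closedBall z₀ R, ∀ z' ∈ Metric.closedBall z₀ R, |f₂ z - f₂ z'| ≤ L * ‖z - z'‖)
    (hl : ∀ z ∈ Metric.closedBall z₀ R, ∀ z' ∈ Metric.closedBall z₀ R,
      |l z - l z'| ≤ L' * ‖z - z'‖)
    (hφ : ContDiff ℝ 1 φ)
    (hmin : ∀ z ∈ Metric.closedBall z₀ R,
      f₁ z₀ + f₂ z₀ + l z₀ + φ z₀ ≤ f₁ z + f₂ z + l z + φ z)
    {δ : ℝ} (hδ : 0 < δ) :
    ∃ z₁ ∈ Metric.ball z₀ δ, ∃ z₂ ∈ Metric.ball z₀ δ, ∃ z₃ ∈ Metric.ball z₀ δ,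
      ∃ p₁ p₂ p₃ : E →L[ℝ] ℝ,
      IsViscositySubgradient f₁ z₁ p₁ ∧ IsViscositySubgradient f₂ z₂ p₂ ∧
      IsViscositySubgradient l z₃ p₃ ∧
      ‖p₁ + p₂ + p₃ + fderiv ℝ φ z₀‖ ≤ δ ∧
      ‖p₁‖ ≤ L + L' + ‖fderiv ℝ φ z₀‖ + δ ∧ ‖p₂‖ ≤ L + L' + ‖fderiv ℝ φ z₀‖ + δ := by
  -- The cap by `R` keeps the intermediate points in the ball where the Lipschitz bounds hold.
  have hη : 0 < min (δ / 2) R := by positivity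
  have hη1 : min (δ / 2) R ≤ δ / 2 := min_le_left _ _
  obtain ⟨z, hz, z₃, hz₃, p, p₃, hp, hp₃, hle⟩ := exists_isViscositySubgradient_add hb
    (f := fun z => f₁ z + f₂ z) hR hL' (hf₁.add hf₂) hl hφ hmin hη
  have hzR : z ∈ Metric.ball z₀ R := Metric.ball_subset_ball (min_le_right _ _) hz
  have hn₃ : ‖p₃‖ ≤ L' := hp₃.norm_le_of_abs_sub_le hL' hl
    (Metric.ball_subset_ball (min_le_right _ _) hz₃)
  have hnp : ‖p‖ ≤ L' + ‖fderiv ℝ φ z₀‖ + δ / 2 := by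
    have : p = (p + p₃ + fderiv ℝ φ z₀) - p₃ - fderiv ℝ φ z₀ := by abel
    rw [this]
    have h1 := norm_sub_le (p + p₃ + fderiv ℝ φ z₀ - p₃) (fderiv ℝ φ z₀)
    have h2 := norm_sub_le (p + p₃ + fderiv ℝ φ z₀) p₃
    linarith
  have hball : Metric.ball z (δ / 2) ⊆ Metric.ball z₀ δ := by
    refine Metric.ball_subset_ball' ?_
    have : dist z z₀ < min (δ / 2) R := hz
    linarith
  -- Whichever of `f₁`, `f₂` is Lipschitz is split off. Its subgradient is at most `L` in norm, and
  -- the other one is then bounded through the sum.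
  have key : ∃ z₁ ∈ Metric.ball z (δ / 2), ∃ z₂ ∈ Metric.ball z (δ / 2), ∃ p₁ p₂ : E →L[ℝ] ℝ,
      IsViscositySubgradient f₁ z₁ p₁ ∧ IsViscositySubgradient f₂ z₂ p₂ ∧
      ‖p₁ + p₂ - p‖ ≤ δ / 2 ∧ ‖p₁‖ ≤ L + ‖p‖ + δ / 2 ∧ ‖p₂‖ ≤ L + ‖p‖ + δ / 2 := by
    rcases hf with h | h
    · simp only [add_comm (f₁ _)] at hp
      obtain ⟨z₂, hz₂, z₁, hz₁, p₂, p₁, h₂, h₁, hle, hn₂, hn₁⟩ :=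
        hp.exists_add hb hL hf₂ h hzR (half_pos hδ)
      exact ⟨z₁, hz₁, z₂, hz₂, p₁, p₂, h₁, h₂, by rwa [add_comm p₁], hn₁, hn₂⟩
    · exact hp.exists_add hb hL hf₁ h hzR (half_pos hδ)
  obtain ⟨z₁, hz₁, z₂, hz₂, p₁, p₂, h₁, h₂, hle', hn₁, hn₂⟩ := key
  refine ⟨z₁, hball hz₁, z₂, hball hz₂, z₃, Metric.ball_subset_ball (by linarith) hz₃, p₁, p₂, p₃,
    h₁, h₂, hp₃, ?_, by linarith, by linarith⟩
  have : p₁ + p₂ + p₃ + fderiv ℝ φ z₀ = (p₁ + p₂ - p) + (p + p₃ + fderiv ℝ φ z₀) := by abel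
  rw [this]
  have := norm_add_le (p₁ + p₂ - p) (p + p₃ + fderiv ℝ φ z₀)
  linarith

end FuzzySumThree

/-! ### The Finsler distance -/

section FinslerPaths

variable {X : Type*} [NormedAddCommGroup X] [NormedSpace ℝ X]
  {M : Type*} [TopologicalSpace M] [ChartedSpace X M]
  {F : ∀ x : M, TangentSpace 𝓘(ℝ, X) x → ℝ}

/-- The speed `‖c'(t)‖_{c(t)}` of a path. -/
noncomputable def finslerSpeed (F : ∀ x : M, TangentSpace 𝓘(ℝ, X) x → ℝ) (c : ℝ → M) (t : ℝ) :
    ℝ≥0∞ :=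
  ENNReal.ofReal (F (c t) (mfderiv 𝓘(ℝ, ℝ) 𝓘(ℝ, X) c t (1 : ℝ)))

/-- The Finsler distance with values in `[0, ∞]`. -/
noncomputable def finslerEDist (F : ∀ x : M, TangentSpace 𝓘(ℝ, X) x → ℝ) (p q : M) : ℝ≥0∞ :=
  sInf {L : ℝ≥0∞ | ∃ (a b : ℝ) (c : ℝ → M), IsPiecewiseC1Path X c a b ∧ c a = p ∧ c b = q ∧
    L = finslerLength F c a b}

theorem finslerDist_eq_toReal (p q : M) : finslerDist F p q = (finslerEDist F p q).toReal := rfl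

theorem finslerDist_nonneg (p q : M) : 0 ≤ finslerDist F p q := ENNReal.toReal_nonneg

theorem finslerLength_eq_lintegral (c : ℝ → M) (a b : ℝ) :
    finslerLength F c a b = ∫⁻ t in Icc a b, finslerSpeed F c t := rfl

theorem finslerEDist_le_finslerLength {c : ℝ → M} {a b : ℝ} (hc : IsPiecewiseC1Path X c a b) :
    finslerEDist F (c a) (c b) ≤ finslerLength F c a b :=
  sInf_le ⟨a, b, c, hc, rfl, rfl, rfl⟩

theorem finslerEDist_self (p : M) : finslerEDist F p p = 0 := by
  have h : IsPiecewiseC1Path X (fun _ : ℝ => p) 0 0 :=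
    ⟨0, fun _ => 0, monotone_const, rfl, rfl, fun i hi => absurd hi (Nat.not_lt_zero i)⟩
  have := finslerEDist_le_finslerLength (F := F) h
  simpa [finslerLength] using this

theorem IsPiecewiseC1Path.le {c : ℝ → M} {a b : ℝ} (hc : IsPiecewiseC1Path X c a b) : a ≤ b := by
  obtain ⟨n, s, hs, rfl, rfl, -⟩ := hc
  exact hs (Nat.zero_le n)

theorem finslerSpeed_congr {c c' : ℝ → M} {t : ℝ} (h : c =ᶠ[𝓝 t] c') :
    finslerSpeed F c t = finslerSpeed F c' t := by
  have A : c t = c' t := h.eq_of_nhds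
  simp only [finslerSpeed]
  congr! 2
  exact congrArg (fun A : ℝ →L[ℝ] X => A 1)
    (Filter.EventuallyEq.mfderiv_eq (I := 𝓘(ℝ, ℝ)) (I' := 𝓘(ℝ, X)) h)

theorem finslerLength_congr {c c' : ℝ → M} {a b : ℝ} (h : EqOn c c' (Ioo a b)) :
    finslerLength F c a b = finslerLength F c' a b := by
  simp only [finslerLength_eq_lintegral, ← restrict_Ioo_eq_restrict_Icc]
  refine setLIntegral_congr_fun measurableSet_Ioo fun t ht => finslerSpeed_congr ?_
  filter_upwards [Ioo_mem_nhds ht.1 ht.2] with x hx using h hx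

theorem finslerLength_add (c : ℝ → M) {a b d : ℝ} (h : a ≤ b) (h' : b ≤ d) :
    finslerLength F c a b + finslerLength F c b d = finslerLength F c a d := by
  have hu : Icc a d = Icc a b ∪ Ioc b d := (Icc_union_Ioc_eq_Icc h h').symm
  rw [finslerLength_eq_lintegral, finslerLength_eq_lintegral, finslerLength_eq_lintegral, hu,
    lintegral_union measurableSet_Ioc, restrict_Ioc_eq_restrict_Icc]
  exact disjoint_iff_forall_ne.mpr fun x hx y hy => (hx.2.trans_lt hy.1).ne

theorem IsPiecewiseC1Path.comp_neg {c : ℝ → M} {a b : ℝ} (hc : IsPiecewiseC1Path X c a b) :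
    IsPiecewiseC1Path X (fun t => c (-t)) (-b) (-a) := by
  obtain ⟨n, s, hs, rfl, rfl, h⟩ := hc
  refine ⟨n, fun i => -s (n - i), fun i j hij => neg_le_neg (hs (by omega)), by simp, by simp,
    fun i hi => ?_⟩
  have h1 := h (n - (i + 1)) (by omega)
  rw [show n - (i + 1) + 1 = n - i by omega] at h1
  refine h1.comp (t := Icc (s (n - (i + 1))) (s (n - i))) contDiff_neg.contMDiff.contMDiffOn
    fun t ht => ?_
  exact ⟨by simpa using neg_le_neg ht.2, by simpa using neg_le_neg ht.1⟩

theorem IsPiecewiseC1Path.comp_add {c : ℝ → M} {a b : ℝ} (hc : IsPiecewiseC1Path X c a b) (k : ℝ) :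
    IsPiecewiseC1Path X (fun t => c (t + k)) (a - k) (b - k) := by
  obtain ⟨n, s, hs, rfl, rfl, h⟩ := hc
  refine ⟨n, fun i => s i - k, fun i j hij => sub_le_sub_right (hs hij) k, rfl, rfl,
    fun i hi => ?_⟩
  refine (h i hi).comp (t := Icc (s i) (s (i + 1)))
    (contDiff_id.add contDiff_const).contMDiff.contMDiffOn fun t ht => ?_
  exact ⟨by have := ht.1; simp only; linarith, by have := ht.2; simp only; linarith⟩

theorem IsPiecewiseC1Path.concat {c c' : ℝ → M} {a b d : ℝ} (hc : IsPiecewiseC1Path X c a b)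
    (hc' : IsPiecewiseC1Path X c' b d) (hb : c b = c' b) :
    IsPiecewiseC1Path X (fun t => if t ≤ b then c t else c' t) a d := by
  obtain ⟨n, s, hs, rfl, rfl, h⟩ := hc
  obtain ⟨n', s', hs', h0, rfl, h'⟩ := hc'
  refine ⟨n + n', fun i => if i ≤ n then s i else s' (i - n), ?_, by simp, ?_, ?_⟩
  · refine monotone_nat_of_le_succ fun i => ?_
    rcases lt_trichotomy i n with hi | rfl | hi
    · rw [if_pos hi.le, if_pos (by omega)]; exact hs (Nat.le_succ i)
    · rw [if_pos le_rfl, if_neg (by omega), ← h0]; exact hs' (Nat.zero_le _)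
    · rw [if_neg (by omega), if_neg (by omega)]; exact hs' (by omega)
  · rcases Nat.eq_zero_or_pos n' with rfl | hn'
    · simp [h0]
    · simp only; rw [if_neg (by omega)]; simp
  · intro i hi
    simp only
    rcases lt_or_ge i n with hin | hin
    · rw [if_pos hin.le, if_pos (by omega)]
      refine (h i hin).congr fun t ht => ?_
      rw [if_pos (ht.2.trans (hs (by omega)))]
    · have e1 : (if i ≤ n then s i else s' (i - n)) = s' (i - n) := by
        rcases hin.eq_or_lt with rfl | hlt
        · simp [h0]
        · rw [if_neg (by omega)]
      rw [e1, if_neg (by omega), show i + 1 - n = i - n + 1 by omega]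
      refine (h' (i - n) (by omega)).congr fun t ht => ?_
      have ht1 : s n ≤ t := h0 ▸ (hs' (Nat.zero_le _)).trans ht.1
      rcases ht1.eq_or_lt with rfl | hlt
      · rw [if_pos le_rfl, hb]
      · rw [if_neg (not_le.2 hlt)]

variable [IsManifold 𝓘(ℝ, X) 1 M]

theorem IsPalaisFinsler.map_zero (hF : IsPalaisFinsler F) (x : M) : F x 0 = 0 := by
  simpa using hF.smul x 0 0

/-- The condition `|σ| = 1` treats translation and reversal of time together; these give the
triangle inequality and the symmetry of the distance. -/
theorem finslerSpeed_comp_affine (hF : IsPalaisFinsler F) (c : ℝ → M) {σ k : ℝ} (hσ : |σ| = 1)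
    (t : ℝ) : finslerSpeed F (fun t => c (σ * t + k)) t = finslerSpeed F c (σ * t + k) := by
  have hσ0 : σ ≠ 0 := by rintro rfl; simp at hσ
  have he : ∀ σ k t : ℝ, HasMFDerivAt 𝓘(ℝ, ℝ) 𝓘(ℝ, ℝ) (fun t : ℝ => σ * t + k) t
      (ContinuousLinearMap.toSpanSingleton ℝ σ) := fun σ k t => by
    have : HasDerivAt (fun t : ℝ => σ * t + k) σ t := by
      simpa using ((hasDerivAt_id t).const_mul σ).add_const k
    exact this.hasFDerivAt.hasMFDerivAt
  by_cases hd : MDifferentiableAt 𝓘(ℝ, ℝ) 𝓘(ℝ, X) c (σ * t + k)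
  · have h1 := (HasMFDerivAt.comp t (f := fun t : ℝ => σ * t + k) hd.hasMFDerivAt (he σ k t)).mfderiv
    have h2 : mfderiv 𝓘(ℝ, ℝ) 𝓘(ℝ, X) (fun t => c (σ * t + k)) t (1 : ℝ) =
        σ • (mfderiv 𝓘(ℝ, ℝ) 𝓘(ℝ, X) c (σ * t + k) (1 : ℝ) : X) := by
      refine (congrArg (fun (A : ℝ →L[ℝ] X) => A 1) h1).trans ?_
      refine Eq.trans ?_ (map_smul (mfderiv 𝓘(ℝ, ℝ) 𝓘(ℝ, X) c (σ * t + k) : ℝ →L[ℝ] X) σ 1)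
      exact congrArg (mfderiv 𝓘(ℝ, ℝ) 𝓘(ℝ, X) c (σ * t + k) : ℝ →L[ℝ] X) (mul_comm (1 : ℝ) σ)
    simp only [finslerSpeed]
    rw [h2]
    congr 1
    exact (hF.smul _ σ _).trans (by rw [hσ, one_mul])
  -- The affine change of time is invertible, so nondifferentiability transfers, and both
  -- derivatives take the default value `0`.
  · have hd' : ¬ MDifferentiableAt 𝓘(ℝ, ℝ) 𝓘(ℝ, X) (fun t => c (σ * t + k)) t := by
      intro h
      apply hd
      have ht : σ⁻¹ * (σ * t + k) + (-(σ⁻¹ * k)) = t := by field_simp; ring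
      have h3 := MDifferentiableAt.comp (σ * t + k) (f := fun t : ℝ => σ⁻¹ * t + (-(σ⁻¹ * k)))
        (g := fun t => c (σ * t + k)) (by rw [ht]; exact h) (he _ _ _).mdifferentiableAt
      refine h3.congr_of_eventuallyEq (Eventually.of_forall fun s => ?_)
      change c s = c (σ * (σ⁻¹ * s + (-(σ⁻¹ * k))) + k)
      congr 1
      field_simp
      ring
    simp only [finslerSpeed]
    rw [mfderiv_zero_of_not_mdifferentiableAt hd, mfderiv_zero_of_not_mdifferentiableAt hd']
    rfl

theorem finslerLength_comp_add (hF : IsPalaisFinsler F) (c : ℝ → M) (k a b : ℝ) :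
    finslerLength F (fun t => c (t + k)) a b = finslerLength F c (a + k) (b + k) := by
  have h := (measurePreserving_add_right volume k).setLIntegral_comp_preimage_emb
    (measurableEmbedding_addRight k) (finslerSpeed F c) (Icc (a + k) (b + k))
  rw [finslerLength_eq_lintegral, finslerLength_eq_lintegral, ← h]
  have hs : (fun t : ℝ => t + k) ⁻¹' Icc (a + k) (b + k) = Icc a b := by
    ext t; simp
  rw [hs]
  refine lintegral_congr fun t => ?_
  have := finslerSpeed_comp_affine hF c (σ := 1) (k := k) (by simp) t
  simpa using this

theorem finslerLength_comp_neg (hF : IsPalaisFinsler F) (c : ℝ → M) (a b : ℝ) :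
    finslerLength F (fun t => c (-t)) (-b) (-a) = finslerLength F c a b := by
  have h := (Measure.measurePreserving_neg (volume : Measure ℝ)).setLIntegral_comp_preimage_emb
    (MeasurableEquiv.neg ℝ).measurableEmbedding (finslerSpeed F c) (Icc a b)
  rw [finslerLength_eq_lintegral, finslerLength_eq_lintegral, ← h]
  have hs : (Neg.neg : ℝ → ℝ) ⁻¹' Icc a b = Icc (-b) (-a) := by
    ext t; simp only [mem_preimage, mem_Icc]; constructor <;> rintro ⟨h1, h2⟩ <;> constructor <;> linarith
  rw [hs]
  refine lintegral_congr fun t => ?_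
  have := finslerSpeed_comp_affine hF c (σ := -1) (k := 0) (by simp) t
  simpa using this

theorem finslerEDist_comm (hF : IsPalaisFinsler F) (p q : M) :
    finslerEDist F p q = finslerEDist F q p := by
  have key : ∀ p q : M, finslerEDist F q p ≤ finslerEDist F p q := by
    intro p q
    refine le_sInf ?_
    rintro _ ⟨a, b, c, hc, rfl, rfl, rfl⟩
    have := finslerEDist_le_finslerLength (F := F) hc.comp_neg
    rwa [finslerLength_comp_neg hF, neg_neg, neg_neg] at this
  exact le_antisymm (key q p) (key p q)

theorem finslerEDist_triangle (hF : IsPalaisFinsler F) (p q r : M) :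
    finslerEDist F p r ≤ finslerEDist F p q + finslerEDist F q r := by
  have key : ∀ L₁ ∈ {L : ℝ≥0∞ | ∃ (a b : ℝ) (c : ℝ → M), IsPiecewiseC1Path X c a b ∧ c a = p ∧
      c b = q ∧ L = finslerLength F c a b}, ∀ L₂ ∈ {L : ℝ≥0∞ | ∃ (a b : ℝ) (c : ℝ → M),
      IsPiecewiseC1Path X c a b ∧ c a = q ∧ c b = r ∧ L = finslerLength F c a b},
      finslerEDist F p r ≤ L₁ + L₂ := by
    rintro _ ⟨a, b, c, hc, rfl, hq, rfl⟩ _ ⟨a', b', c', hc', hq', rfl, rfl⟩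
    have h1 := hc'.comp_add (a' - b)
    rw [sub_sub_cancel] at h1
    have h2 := hc.concat h1 (by simp [hq, hq'])
    have h3 := finslerEDist_le_finslerLength (F := F) h2
    -- The first branch occurs only when the second path lives on a single instant; its value is
    -- then still the common point `q`.
    have e2 : (if b' - (a' - b) ≤ b then c (b' - (a' - b)) else c' (b' - (a' - b) + (a' - b)))
        = c' b' := by
      split_ifs with h
      · have hle := hc'.le
        have e : b' = a' := by linarith
        subst e
        simp [hq, hq']
      · simp
    rw [if_pos hc.le, e2, ← finslerLength_add _ hc.le h1.le] at h3
    refine h3.trans (add_le_add (finslerLength_congr fun t ht => if_pos ht.2.le).le ?_)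
    rw [finslerLength_congr (c' := fun t => c' (t + (a' - b))) fun t ht => if_neg (not_le.2 ht.1),
      finslerLength_comp_add hF]
    simp
  conv_rhs => rw [finslerEDist, finslerEDist]
  rw [ENNReal.add_sInf]
  refine le_iInf₂ fun L₂ h₂ => ?_
  rw [add_comm, ENNReal.add_sInf]
  exact le_iInf₂ fun L₁ h₁ => (key L₁ h₁ L₂ h₂).trans (add_comm _ _).le

end FinslerPaths

/-! ### Finsler structures in charts -/

section FinslerCharts

variable {X : Type*} [NormedAddCommGroup X] [NormedSpace ℝ X]
  {M : Type*} [TopologicalSpace M] [ChartedSpace X M]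
  {F : ∀ x : M, TangentSpace 𝓘(ℝ, X) x → ℝ} {φ : OpenPartialHomeomorph M X}

theorem mdifferentiable_of_mem_maximalAtlas (hφ : φ ∈ IsManifold.maximalAtlas 𝓘(ℝ, X) 1 M) :
    φ.MDifferentiable 𝓘(ℝ, X) 𝓘(ℝ, X) :=
  ⟨(contMDiffOn_of_mem_maximalAtlas hφ).mdifferentiableOn one_ne_zero,
    (contMDiffOn_symm_of_mem_maximalAtlas hφ).mdifferentiableOn one_ne_zero⟩

theorem chartNorm_symm_apply {ξ : X} (hξ : ξ ∈ φ.target) (v : X) :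
    chartNorm F φ (φ.symm ξ) v = F (φ.symm ξ) (mfderiv 𝓘(ℝ, X) 𝓘(ℝ, X) φ.symm ξ v) := by
  have key : ∀ (A : X → X → X) (ζ : X), ζ = ξ →
      F (φ.symm ξ) (A ζ v) = F (φ.symm ξ) (A ξ v) := by rintro A _ rfl; rfl
  exact key (fun ζ v => (mfderiv 𝓘(ℝ, X) 𝓘(ℝ, X) φ.symm ζ v : X)) _ (φ.right_inv hξ)

theorem IsPiecewiseC1Path.induction {P : ℝ → Prop} {c : ℝ → M} {a b : ℝ}
    (hc : IsPiecewiseC1Path X c a b) (ha : P a)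
    (hstep : ∀ s s', a ≤ s → s ≤ s' → s' ≤ b →
      ContMDiffOn 𝓘(ℝ, ℝ) 𝓘(ℝ, X) 1 c (Icc s s') → P s → P s') : P b := by
  obtain ⟨n, s, hs, rfl, rfl, h⟩ := hc
  suffices H : ∀ i ≤ n, P (s i) from H n le_rfl
  intro i
  induction i with
  | zero => exact fun _ => ha
  | succ i ih =>
    intro hi
    exact hstep _ _ (hs (Nat.zero_le i)) (hs (Nat.le_succ i)) (hs hi) (h i hi) (ih (by omega))

theorem finslerDist_self (p : M) : finslerDist F p p = 0 := by
  simp [finslerDist_eq_toReal, finslerEDist_self]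

theorem chartNorm_mfderiv (hφ : φ ∈ IsManifold.maximalAtlas 𝓘(ℝ, X) 1 M) {y : M}
    (hy : y ∈ φ.source) (w : TangentSpace 𝓘(ℝ, X) y) :
    chartNorm F φ y (mfderiv 𝓘(ℝ, X) 𝓘(ℝ, X) φ y w) = F y w := by
  have h := (mdifferentiable_of_mem_maximalAtlas hφ).symm_comp_deriv hy
  exact congrArg (fun A : X →L[ℝ] X => F y (A w)) h

theorem mfderiv_mfderiv_symm (hφ : φ ∈ IsManifold.maximalAtlas 𝓘(ℝ, X) 1 M) {y : M}
    (hy : y ∈ φ.source) (v : X) :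
    (mfderiv 𝓘(ℝ, X) 𝓘(ℝ, X) φ y : X →L[ℝ] X)
      ((mfderiv 𝓘(ℝ, X) 𝓘(ℝ, X) φ.symm (φ y) : X →L[ℝ] X) v) = v := by
  have h := (mdifferentiable_of_mem_maximalAtlas hφ).comp_symm_deriv (φ.map_source hy)
  have key : ∀ (A : M → X →L[ℝ] X) (B : X →L[ℝ] X) (z : M), z = y →
      (A z).comp B = ContinuousLinearMap.id ℝ X → A y (B v) = v := by
    rintro A B _ rfl h
    exact congrArg (fun T : X →L[ℝ] X => T v) h
  exact key (fun z => (mfderiv 𝓘(ℝ, X) 𝓘(ℝ, X) φ z : X →L[ℝ] X)) _ _ (φ.left_inv hy) h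

/-- The chart image of a straight segment is a competitor for the infimum, and its speed is bounded
by `N (ξ' - ξ)`. -/
theorem finslerEDist_symm_le (hφ : φ ∈ IsManifold.maximalAtlas 𝓘(ℝ, X) 1 M)
    {N : X → ℝ} {ζ : X} {r : ℝ} (hr : Metric.ball ζ r ⊆ φ.target)
    (hN : ∀ ξ ∈ Metric.ball ζ r, ∀ v, chartNorm F φ (φ.symm ξ) v ≤ N v)
    {ξ ξ' : X} (hξ : ξ ∈ Metric.ball ζ r) (hξ' : ξ' ∈ Metric.ball ζ r) :
    finslerEDist F (φ.symm ξ) (φ.symm ξ') ≤ ENNReal.ofReal (N (ξ' - ξ)) := by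
  set γ : ℝ → X := fun t => ξ + t • (ξ' - ξ) with hγ
  have hmem : ∀ t ∈ Icc (0 : ℝ) 1, γ t ∈ Metric.ball ζ r := fun t ht =>
    (convex_ball ζ r).add_smul_sub_mem hξ hξ' ht
  have hγC : ContDiff ℝ 1 γ := by fun_prop
  have hc : IsPiecewiseC1Path X (fun t => φ.symm (γ t)) 0 1 := by
    refine ⟨1, fun i => min (i : ℝ) 1, fun i j hij => min_le_min_right _ (by exact_mod_cast hij),
      by simp, by simp, fun i hi => ?_⟩
    obtain rfl : i = 0 := by omega
    refine (contMDiffOn_symm_of_mem_maximalAtlas hφ).comp hγC.contMDiff.contMDiffOn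
      fun t ht => hr (hmem t ?_)
    simpa using ht
  have h1 := finslerEDist_le_finslerLength (F := F) hc
  have e0 : γ 0 = ξ := by simp [hγ]
  have e1 : γ 1 = ξ' := by simp [hγ]
  rw [e0, e1, finslerLength_eq_lintegral] at h1
  refine h1.trans ?_
  have hsp : ∀ t ∈ Icc (0 : ℝ) 1, finslerSpeed F (fun t => φ.symm (γ t)) t
      ≤ ENNReal.ofReal (N (ξ' - ξ)) := by
    intro t ht
    have hγd : HasDerivAt γ (ξ' - ξ) t := by
      simpa [hγ] using ((hasDerivAt_id t).smul_const (ξ' - ξ)).const_add ξ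
    have hd := ((mdifferentiable_of_mem_maximalAtlas hφ).mdifferentiableAt_symm
      (hr (hmem t ht))).hasMFDerivAt
    have h2 := (HasMFDerivAt.comp t hd hγd.hasFDerivAt.hasMFDerivAt).mfderiv
    have h3 : (mfderiv 𝓘(ℝ, ℝ) 𝓘(ℝ, X) (fun t => φ.symm (γ t)) t (1 : ℝ) : X)
        = (mfderiv 𝓘(ℝ, X) 𝓘(ℝ, X) φ.symm (γ t) : X →L[ℝ] X) (ξ' - ξ) := by
      refine (congrArg (fun (A : ℝ →L[ℝ] X) => A 1) h2).trans ?_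
      exact congrArg (mfderiv 𝓘(ℝ, X) 𝓘(ℝ, X) φ.symm (γ t) : X →L[ℝ] X) (one_smul ℝ (ξ' - ξ))
    refine ENNReal.ofReal_le_ofReal ?_
    refine le_trans (le_of_eq ?_) (hN (γ t) (hmem t ht) (ξ' - ξ))
    rw [chartNorm_symm_apply (hr (hmem t ht))]
    exact congrArg (F (φ.symm (γ t))) h3
  refine (setLIntegral_mono' measurableSet_Icc hsp).trans ?_
  simp

/-- The length of a `C¹` path in a chart domain controls the distance of the endpoints in the
chart. -/
theorem enorm_sub_le_finslerLength (hφ : φ ∈ IsManifold.maximalAtlas 𝓘(ℝ, X) 1 M) {κ : ℝ}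
    {c : ℝ → M} {s t : ℝ} (hst : s ≤ t)
    (hc : ContMDiffOn 𝓘(ℝ, ℝ) 𝓘(ℝ, X) 1 c (Icc s t)) (hκ0 : 0 ≤ κ)
    (hsrc : ∀ y ∈ Icc s t, c y ∈ φ.source)
    (hκ : ∀ y ∈ Icc s t, ∀ v, ‖v‖ ≤ κ * chartNorm F φ (c y) v) :
    ‖φ (c t) - φ (c s)‖ₑ ≤ ENNReal.ofReal κ * finslerLength F c s t := by
  have hC : ContMDiffOn 𝓘(ℝ, ℝ) 𝓘(ℝ, X) 1 (φ ∘ c) (Icc s t) :=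
    (contMDiffOn_of_mem_maximalAtlas hφ).comp hc hsrc
  refine (enorm_sub_le_lintegral_deriv_of_contDiffOn_Icc hC.contDiffOn hst).trans ?_
  rw [finslerLength_eq_lintegral, ← lintegral_const_mul' _ _ ENNReal.ofReal_ne_top,
    ← restrict_Ioo_eq_restrict_Icc]
  refine setLIntegral_mono' measurableSet_Ioo fun y hy => ?_
  have hy' : y ∈ Icc s t := Ioo_subset_Icc_self hy
  have hcd := ((hc y hy').contMDiffAt (Icc_mem_nhds hy.1 hy.2)).mdifferentiableAt one_ne_zero
  have hφd := (mdifferentiable_of_mem_maximalAtlas hφ).mdifferentiableAt (hsrc y hy')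
  have h1 := (HasMFDerivAt.comp y hφd.hasMFDerivAt hcd.hasMFDerivAt).mfderiv
  rw [mfderiv_eq_fderiv] at h1
  have h2 : deriv (φ ∘ c) y = mfderiv 𝓘(ℝ, X) 𝓘(ℝ, X) φ (c y)
      (mfderiv 𝓘(ℝ, ℝ) 𝓘(ℝ, X) c y (1 : ℝ)) := by
    exact congrArg (fun A : ℝ →L[ℝ] X => A 1) h1
  have h3 := hκ y hy' (deriv (φ ∘ c) y)
  rw [h2, chartNorm_mfderiv hφ (hsrc y hy')] at h3
  rw [← ofReal_norm, finslerSpeed, ← ENNReal.ofReal_mul hκ0, h2]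
  exact ENNReal.ofReal_le_ofReal h3

theorem finslerDist_symm_le (hφ : φ ∈ IsManifold.maximalAtlas 𝓘(ℝ, X) 1 M)
    {N : X → ℝ} {ζ : X} {r : ℝ} (hr : Metric.ball ζ r ⊆ φ.target) (hN0 : ∀ v, 0 ≤ N v)
    (hN : ∀ ξ ∈ Metric.ball ζ r, ∀ v, chartNorm F φ (φ.symm ξ) v ≤ N v)
    {ξ ξ' : X} (hξ : ξ ∈ Metric.ball ζ r) (hξ' : ξ' ∈ Metric.ball ζ r) :
    finslerDist F (φ.symm ξ) (φ.symm ξ') ≤ N (ξ' - ξ) :=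
  ENNReal.toReal_le_of_le_ofReal (hN0 _) (finslerEDist_symm_le hφ hr hN hξ hξ')

variable [IsManifold 𝓘(ℝ, X) 1 M]

theorem exists_chart_ball (hF : IsPalaisFinsler F)
    (hφ : φ ∈ IsManifold.maximalAtlas 𝓘(ℝ, X) 1 M) {x₀ : M} (hx₀ : x₀ ∈ φ.source) {δ : ℝ}
    (hδ : 0 < δ) {U : Set M} (hU : U ∈ 𝓝 x₀) :
    ∃ r > 0, Metric.ball (φ x₀) r ⊆ φ.target ∧ ∀ ξ ∈ Metric.ball (φ x₀) r, φ.symm ξ ∈ U ∧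
      ∀ v, (1 + δ)⁻¹ * chartNorm F φ x₀ v ≤ chartNorm F φ (φ.symm ξ) v ∧
        chartNorm F φ (φ.symm ξ) v ≤ (1 + δ) * chartNorm F φ x₀ v := by
  obtain ⟨W, hWo, hxW, hWs, hW⟩ := hF.palais φ hφ x₀ hx₀ δ hδ
  have h1 : Tendsto φ.symm (𝓝 (φ x₀)) (𝓝 x₀) := by
    have := φ.continuousAt_symm (φ.map_source hx₀)
    rwa [ContinuousAt, φ.left_inv hx₀] at this
  have h2 : φ.target ∩ φ.symm ⁻¹' (W ∩ U) ∈ 𝓝 (φ x₀) :=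
    inter_mem (φ.open_target.mem_nhds (φ.map_source hx₀)) (h1 (inter_mem (hWo.mem_nhds hxW) hU))
  obtain ⟨r, hr, hball⟩ := Metric.mem_nhds_iff.1 h2
  exact ⟨r, hr, fun ξ hξ => (hball hξ).1, fun ξ hξ => ⟨(hball hξ).2.2, hW _ (hball hξ).2.1⟩⟩

/-- Every neighborhood of a point of a regular Finsler manifold contains a ball for the Finsler
distance. -/
theorem exists_finslerEDist_lt_imp_mem [RegularSpace M] (hF : IsPalaisFinsler F) (x₀ : M)
    {U : Set M} (hU : U ∈ 𝓝 x₀) : ∃ ρ > 0, ∀ y, finslerEDist F x₀ y < ENNReal.ofReal ρ → y ∈ U := by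
  set φ := chartAt X x₀ with hφdef
  have hφ : φ ∈ IsManifold.maximalAtlas 𝓘(ℝ, X) 1 M := IsManifold.chart_mem_maximalAtlas x₀
  have hx₀ : x₀ ∈ φ.source := mem_chart_source X x₀
  obtain ⟨K, hK1, hK⟩ := hF.equivalent φ hφ x₀ hx₀
  have hK0 : 0 < K := by linarith
  obtain ⟨r₁, hr₁, hr₁t, hr₁N⟩ := exists_chart_ball hF hφ hx₀ one_pos hU
  -- Regularity provides a closed neighborhood `C` inside the chart on which the norms are
  -- comparable; a smaller chart ball gives an open `O` inside `C`.
  have hV : φ.source ∩ φ ⁻¹' Metric.ball (φ x₀) r₁ ∈ 𝓝 x₀ :=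
    inter_mem (φ.open_source.mem_nhds hx₀)
      ((φ.continuousAt hx₀).preimage_mem_nhds (Metric.ball_mem_nhds _ hr₁))
  obtain ⟨C, hCn, hCc, hCV⟩ := exists_mem_nhds_isClosed_subset hV
  obtain ⟨r, hr, hrt, hrC⟩ := exists_chart_ball hF hφ hx₀ one_pos hCn
  set O : Set M := φ.source ∩ φ ⁻¹' Metric.ball (φ x₀) r with hO
  have hOo : IsOpen O := φ.isOpen_inter_preimage Metric.isOpen_ball
  have hOC : O ⊆ C := fun y hy => by
    have := (hrC (φ y) hy.2).1
    rwa [φ.left_inv hy.1] at this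
  have hCN : ∀ y ∈ C, ∀ v, ‖v‖ ≤ 2 * K * chartNorm F φ y v := by
    intro y hy v
    have h1 := ((hr₁N (φ y) (hCV hy).2).2 v).1
    rw [φ.left_inv (hCV hy).1] at h1
    have h2 := (hK v).1
    norm_num at h1
    rw [inv_mul_le_iff₀ hK0] at h2
    nlinarith
  -- On `C`, the norm of `X` is at most `2 * K` times the Finsler norm: `K` by equivalence at `x₀`,
  -- and `2` by Palais' condition with `ε = 1`. A path shorter than `r / (2 * K)` thus moves less
  -- than `r` in the chart.
  refine ⟨r / (2 * K), by positivity, fun y hy => ?_⟩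
  obtain ⟨_, ⟨a, b, c, hc, hca, rfl, rfl⟩, hlt⟩ := sInf_lt_iff.1 hy
  have hlen : ENNReal.ofReal (2 * K) * finslerLength F c a b < ENNReal.ofReal r := by
    have := ENNReal.mul_lt_mul_right (a := ENNReal.ofReal (2 * K)) (by simpa using hK0)
      ENNReal.ofReal_ne_top hlt
    rwa [← ENNReal.ofReal_mul (by positivity), mul_div_cancel₀ _ (by positivity)] at this
  have hinO : ∀ z ∈ φ.source, ‖φ z - φ x₀‖ₑ < ENNReal.ofReal r → z ∈ O := by
    intro z hz hlt
    rw [← ofReal_norm, ENNReal.ofReal_lt_ofReal_iff hr, ← dist_eq_norm] at hlt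
    exact ⟨hz, hlt⟩
  have hfinal : c b ∈ O ∧ ‖φ (c b) - φ x₀‖ₑ ≤ ENNReal.ofReal (2 * K) * finslerLength F c a b := by
    refine hc.induction (P := fun t => c t ∈ O ∧
      ‖φ (c t) - φ x₀‖ₑ ≤ ENNReal.ofReal (2 * K) * finslerLength F c a t) ?_ ?_
    · simp only [hca, sub_self, enorm_zero, zero_le, and_true]
      exact ⟨hx₀, Metric.mem_ball_self hr⟩
    · rintro s s' has hss' hs'b hcC ⟨hsO, hsle⟩
      have hest : ∀ t ∈ Icc s s', Icc s t ⊆ c ⁻¹' C →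
          c t ∈ φ.source → ‖φ (c t) - φ x₀‖ₑ ≤ ENNReal.ofReal (2 * K) * finslerLength F c a t := by
        intro t ht hsub htsrc
        have h1 := enorm_sub_le_finslerLength (F := F) hφ ht.1
          (hcC.mono (Icc_subset_Icc_right ht.2)) (by positivity : 0 ≤ 2 * K)
          (fun y hy => (hCV (hsub hy)).1) (fun y hy => hCN _ (hsub hy))
        rw [← finslerLength_add c has ht.1, mul_add]
        calc ‖φ (c t) - φ x₀‖ₑ = ‖(φ (c s) - φ x₀) + (φ (c t) - φ (c s))‖ₑ := by
              congr 1; abel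
          _ ≤ _ := (enorm_add_le _ _).trans (add_le_add hsle h1)
      have hestO : ∀ t ∈ Icc s s', Icc s t ⊆ c ⁻¹' C → c t ∈ O := by
        intro t ht hsub
        have htsrc := (hCV (hsub (right_mem_Icc.2 ht.1))).1
        refine hinO _ htsrc ((hest t ht hsub htsrc).trans_lt (lt_of_le_of_lt ?_ hlen))
        gcongr
        rw [← finslerLength_add c (has.trans ht.1) (ht.2.trans hs'b)]
        exact le_self_add
      -- The path cannot leave the chart domain: the times spent in `C` form a closed set, and while
      -- the path has stayed in `C` the length estimate places it in the open set `O`, hence in `C`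
      -- a little longer.
      have hall : Icc s s' ⊆ c ⁻¹' C := by
        have hcl : IsClosed (c ⁻¹' C ∩ Icc s s') := by
          rw [inter_comm]
          exact hcC.continuousOn.preimage_isClosed_of_isClosed isClosed_Icc hCc
        refine hcl.Icc_subset_of_forall_mem_nhdsGT_of_Icc_subset (hOC hsO) fun t ht hsub => ?_
        have hcont : ContinuousWithinAt c (Icc s s') t := hcC.continuousOn t ⟨ht.1, ht.2.le⟩
        have h1 : c ⁻¹' C ∈ 𝓝[Icc s s'] t :=
          hcont (mem_of_superset (hOo.mem_nhds (hestO t ⟨ht.1, ht.2.le⟩ hsub)) hOC)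
        refine nhdsWithin_le_iff.2 ?_ h1
        exact mem_of_superset (Ioo_mem_nhdsGT ht.2) fun y hy => ⟨ht.1.trans hy.1.le, hy.2.le⟩
      have hmem := hestO s' (right_mem_Icc.2 hss') hall
      exact ⟨hmem, hest s' (right_mem_Icc.2 hss') hall hmem.1⟩
  have := (hr₁N (φ (c b)) (hCV (hOC hfinal.1)).2).1
  rwa [φ.left_inv hfinal.1.1] at this

theorem eventually_finslerEDist_lt_top (hF : IsPalaisFinsler F) (x₀ : M) :
    ∀ᶠ y in 𝓝 x₀, finslerEDist F x₀ y < ⊤ := by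
  set φ := chartAt X x₀ with hφdef
  have hφ : φ ∈ IsManifold.maximalAtlas 𝓘(ℝ, X) 1 M := IsManifold.chart_mem_maximalAtlas x₀
  have hx₀ : x₀ ∈ φ.source := mem_chart_source X x₀
  obtain ⟨r, hr, hrt, hrN⟩ := exists_chart_ball hF hφ hx₀ one_pos univ_mem
  filter_upwards [(φ.continuousAt hx₀).preimage_mem_nhds (Metric.ball_mem_nhds _ hr),
    φ.open_source.mem_nhds hx₀] with y hy hys
  have h := finslerEDist_symm_le hφ hrt (fun ξ hξ v => ((hrN ξ hξ).2 v).2)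
    (Metric.mem_ball_self hr) hy
  rw [φ.left_inv hx₀, φ.left_inv hys] at h
  exact h.trans_lt ENNReal.ofReal_lt_top

/-- Nearby points are at finite distance, so the points at finite distance from `p` form a nonempty
clopen set. -/
theorem finslerEDist_ne_top [PreconnectedSpace M] (hF : IsPalaisFinsler F) (p q : M) :
    finslerEDist F p q ≠ ⊤ := by
  have hopen : IsOpen {y | finslerEDist F p y < ⊤} := by
    rw [isOpen_iff_mem_nhds]
    intro y hy
    filter_upwards [eventually_finslerEDist_lt_top hF y] with z hz
    exact (finslerEDist_triangle hF p y z).trans_lt (ENNReal.add_lt_top.2 ⟨hy, hz⟩)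
  have hclosed : IsClosed {y | finslerEDist F p y < ⊤} := by
    rw [← isOpen_compl_iff, isOpen_iff_mem_nhds]
    intro y hy
    filter_upwards [eventually_finslerEDist_lt_top hF y] with z hz hz'
    refine hy ((finslerEDist_triangle hF p z y).trans_lt (ENNReal.add_lt_top.2 ⟨hz', ?_⟩))
    rwa [finslerEDist_comm hF]
  have huniv := IsClopen.eq_univ ⟨hclosed, hopen⟩ ⟨p, by simp [finslerEDist_self]⟩
  have : q ∈ {y | finslerEDist F p y < ⊤} := huniv ▸ mem_univ q
  exact ne_of_lt this

theorem finslerDist_comm (hF : IsPalaisFinsler F) (p q : M) :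
    finslerDist F p q = finslerDist F q p := by
  simp only [finslerDist_eq_toReal, finslerEDist_comm hF p q]

theorem finslerDist_triangle [PreconnectedSpace M] (hF : IsPalaisFinsler F) (p q r : M) :
    finslerDist F p r ≤ finslerDist F p q + finslerDist F q r := by
  simp only [finslerDist_eq_toReal]
  rw [← ENNReal.toReal_add (finslerEDist_ne_top hF p q) (finslerEDist_ne_top hF q r)]
  exact ENNReal.toReal_mono (ENNReal.add_ne_top.2 ⟨finslerEDist_ne_top hF p q,
    finslerEDist_ne_top hF q r⟩) (finslerEDist_triangle hF p q r)

/-- Completeness concerns the Finsler distance, while semicontinuity concerns the topology of `M`;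
Ekeland's principle needs this link. -/
theorem tendsto_of_tendsto_finslerDist [PreconnectedSpace M] [RegularSpace M]
    (hF : IsPalaisFinsler F) {ι : Type*} {l : Filter ι} {s : ι → M} {x : M}
    (h : Tendsto (fun i => finslerDist F (s i) x) l (𝓝 0)) : Tendsto s l (𝓝 x) := by
  refine tendsto_def.2 fun U hU => ?_
  obtain ⟨ρ, hρ, hsub⟩ := exists_finslerEDist_lt_imp_mem hF x hU
  filter_upwards [h.eventually_lt_const hρ] with i hi
  refine hsub _ ?_
  rw [finslerEDist_comm hF, ENNReal.lt_ofReal_iff_toReal_lt (finslerEDist_ne_top hF _ _)]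
  exact hi

end FinslerCharts

/-! ### Sub- and superdifferentials in charts -/

section ChartTransfer

variable {X : Type*} [NormedAddCommGroup X] [NormedSpace ℝ X]
  {M : Type*} [TopologicalSpace M] [ChartedSpace X M]
  {F : ∀ x : M, TangentSpace 𝓘(ℝ, X) x → ℝ} {φ : OpenPartialHomeomorph M X}

theorem IsNormalizedBump.exists_cutoff {b : X → ℝ} {K : ℝ} (hb : IsNormalizedBump b K) (ζ : X)
    {r : ℝ} (hr : 0 < r) :
    ∃ χ : X → ℝ, ContDiff ℝ 1 χ ∧ (∀ᶠ ξ in 𝓝 ζ, χ ξ = 1) ∧ ∀ ξ, ξ ∉ Metric.ball ζ r → χ ξ = 0 := by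
  -- The bump equals `1` only at its center; doubling it and composing with a transition that is
  -- constant beyond `1` makes it `1` near the center.
  refine ⟨fun ξ => Real.smoothTransition (2 * b (r⁻¹ • (ξ - ζ))), ?_, ?_, ?_⟩
  · exact Real.smoothTransition.contDiff.comp (contDiff_const.mul (hb.contDiff_rescale _ _))
  · have hc : ContinuousAt (fun ξ => b (r⁻¹ • (ξ - ζ))) ζ :=
      (hb.contDiff_rescale r⁻¹ ζ).continuous.continuousAt
    have h1 : (1 / 2 : ℝ) < b (r⁻¹ • (ζ - ζ)) := by
      rw [sub_self, smul_zero, hb.map_zero]; norm_num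
    filter_upwards [hc.eventually (lt_mem_nhds h1)] with ξ hξ
    exact Real.smoothTransition.one_of_one_le (by linarith)
  · intro ξ hξ
    have : b (r⁻¹ • (ξ - ζ)) = 0 := by
      apply hb.eq_zero
      rw [norm_smul, Real.norm_of_nonneg (by positivity), inv_mul_eq_div, one_le_div hr,
        ← dist_eq_norm]
      simpa using hξ
    simp only [this, mul_zero]
    exact Real.smoothTransition.zero_of_nonpos le_rfl

/-- A `C¹` function in a chart of `M` (times `ℝ`) agrees near a given point with a global `C¹`
function. -/
theorem exists_contMDiff_eventuallyEq [RegularSpace M] {b : X → ℝ} {K : ℝ}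
    (hb : IsNormalizedBump b K) (hφ : φ ∈ IsManifold.maximalAtlas 𝓘(ℝ, X) 1 M) {y : M}
    (hy : y ∈ φ.source) (t : ℝ) {G : ℝ × X → ℝ} (hG : ContDiff ℝ 1 G) :
    ∃ g : ℝ × M → ℝ, ContMDiff (𝓘(ℝ, ℝ).prod 𝓘(ℝ, X)) 𝓘(ℝ, ℝ) 1 g ∧
      g =ᶠ[𝓝 (t, y)] fun p => G (p.1, φ p.2) := by
  classical
  -- The cut-off function vanishes off a set closed in `M`, not merely closed in the chart domain,
  -- so its extension by `0` is `C¹`.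
  obtain ⟨C, hCn, hCc, hCs⟩ := exists_mem_nhds_isClosed_subset (φ.open_source.mem_nhds hy)
  have h1 : Tendsto φ.symm (𝓝 (φ y)) (𝓝 y) := by
    have := φ.continuousAt_symm (φ.map_source hy)
    rwa [ContinuousAt, φ.left_inv hy] at this
  obtain ⟨r, hr, hball⟩ := Metric.mem_nhds_iff.1 (h1 hCn)
  obtain ⟨χ, hχ, hχ1, hχ0⟩ := hb.exists_cutoff (φ y) hr
  have hsrc : ∀ p : ℝ × M, p.2 ∈ φ.source → ∀ᶠ q in 𝓝 p, q.2 ∈ φ.source := fun p hp =>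
    continuous_snd.continuousAt.preimage_mem_nhds (φ.open_source.mem_nhds hp)
  refine ⟨fun p => if p.2 ∈ φ.source then χ (φ p.2) * G (p.1, φ p.2) else 0, fun p => ?_, ?_⟩
  · by_cases hp : p.2 ∈ φ.source
    · have hφ2 : ContMDiffAt (𝓘(ℝ, ℝ).prod 𝓘(ℝ, X)) 𝓘(ℝ, X) 1 (fun p : ℝ × M => φ p.2) p :=
        ContMDiffAt.comp p (contMDiffAt_of_mem_maximalAtlas hφ hp) contMDiffAt_snd
      have h2 : ContMDiffAt (𝓘(ℝ, ℝ).prod 𝓘(ℝ, X)) 𝓘(ℝ, ℝ) 1 (fun p : ℝ × M => χ (φ p.2)) p :=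
        ContMDiffAt.comp p (g := χ) (f := fun p : ℝ × M => φ p.2) hχ.contMDiff.contMDiffAt hφ2
      have h3 : ContMDiffAt (𝓘(ℝ, ℝ).prod 𝓘(ℝ, X)) 𝓘(ℝ, ℝ) 1
          (fun p : ℝ × M => G (p.1, φ p.2)) p :=
        ContMDiffAt.comp p (g := G) (f := fun p : ℝ × M => (p.1, φ p.2)) hG.contMDiff.contMDiffAt
          (contMDiffAt_fst.prodMk_space hφ2)
      refine (h2.mul h3).congr_of_eventuallyEq ?_
      filter_upwards [hsrc p hp] with q hq
      simp [hq]
    · have hpC : ∀ᶠ q : ℝ × M in 𝓝 p, q.2 ∈ Cᶜ :=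
        continuous_snd.continuousAt.preimage_mem_nhds (hCc.isOpen_compl.mem_nhds fun h => hp (hCs h))
      refine contMDiffAt_const (c := (0 : ℝ)) |>.congr_of_eventuallyEq ?_
      filter_upwards [hpC] with q hq
      split_ifs with hqs
      · rw [hχ0 _ fun hmem => hq ?_, zero_mul]
        have := hball hmem
        rwa [mem_preimage, φ.left_inv hqs] at this
      · rfl
  · have h4 : ∀ᶠ p : ℝ × M in 𝓝 (t, y), χ (φ p.2) = 1 :=
      (ContinuousAt.comp (x := ((t, y) : ℝ × M)) (f := Prod.snd) (g := φ) (φ.continuousAt hy)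
        continuous_snd.continuousAt).eventually hχ1
    filter_upwards [h4, hsrc (t, y) hy] with p h5 h6
    simp [h5, h6]

theorem mvfderiv_chart_apply (hφ : φ ∈ IsManifold.maximalAtlas 𝓘(ℝ, X) 1 M) {y : M}
    (hy : y ∈ φ.source) (t : ℝ) {G : ℝ × X → ℝ} (hG : ContDiff ℝ 1 G) {g : ℝ × M → ℝ}
    (hg : g =ᶠ[𝓝 (t, y)] fun p => G (p.1, φ p.2)) (w : ℝ × X) :
    (mvfderiv (𝓘(ℝ, ℝ).prod 𝓘(ℝ, X)) g (t, y) : ℝ × X →L[ℝ] ℝ) w =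
      fderiv ℝ G (t, φ y) (w.1, (mfderiv 𝓘(ℝ, X) 𝓘(ℝ, X) φ y : X →L[ℝ] X) w.2) := by
  have h1 : HasMFDerivAt (𝓘(ℝ, ℝ).prod 𝓘(ℝ, X)) 𝓘(ℝ, ℝ) (Prod.fst : ℝ × M → ℝ) (t, y)
      (ContinuousLinearMap.fst ℝ ℝ X) := hasMFDerivAt_fst _
  have h2 : HasMFDerivAt (𝓘(ℝ, ℝ).prod 𝓘(ℝ, X)) 𝓘(ℝ, X) (fun p : ℝ × M => φ p.2) (t, y)
      ((mfderiv 𝓘(ℝ, X) 𝓘(ℝ, X) φ y : X →L[ℝ] X) ∘L ContinuousLinearMap.snd ℝ ℝ X) :=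
    HasMFDerivAt.comp ((t, y) : ℝ × M) (g := φ) (f := Prod.snd)
      ((mdifferentiable_of_mem_maximalAtlas hφ).mdifferentiableAt hy).hasMFDerivAt
      (hasMFDerivAt_snd _)
  have h3 : HasMFDerivAt (𝓘(ℝ, ℝ).prod 𝓘(ℝ, X)) 𝓘(ℝ, ℝ × X) (fun p : ℝ × M => (p.1, φ p.2)) (t, y)
      ((ContinuousLinearMap.fst ℝ ℝ X).prod ((mfderiv 𝓘(ℝ, X) 𝓘(ℝ, X) φ y : X →L[ℝ] X) ∘L
        ContinuousLinearMap.snd ℝ ℝ X)) :=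
    ⟨h1.1.prodMk h2.1, h1.2.prodMk h2.2⟩
  have h4 : HasMFDerivAt 𝓘(ℝ, ℝ × X) 𝓘(ℝ, ℝ) G (t, φ y) (fderiv ℝ G (t, φ y)) :=
    ((hG.differentiable one_ne_zero) _).hasFDerivAt.hasMFDerivAt
  have h5 := (HasMFDerivAt.comp ((t, y) : ℝ × M) (g := G)
    (f := fun p : ℝ × M => (p.1, φ p.2)) h4 h3).congr_of_eventuallyEq hg
  have h6 := h5.mfderiv
  exact congrArg (fun A : ℝ × X →L[ℝ] ℝ => A w) h6

theorem finslerDualNorm_nonneg (x : M) (Δ : TangentSpace 𝓘(ℝ, X) x →L[ℝ] ℝ) :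
    0 ≤ finslerDualNorm F x Δ :=
  Real.sSup_nonneg (by rintro _ ⟨ξ, -, rfl⟩; exact abs_nonneg _)

theorem finslerDualNorm_le (hφ : φ ∈ IsManifold.maximalAtlas 𝓘(ℝ, X) 1 M) {y : M}
    (hy : y ∈ φ.source) {Δ : TangentSpace 𝓘(ℝ, X) y →L[ℝ] ℝ} {q : X → ℝ}
    (hq : ∀ w : X, Δ w = q ((mfderiv 𝓘(ℝ, X) 𝓘(ℝ, X) φ y : X →L[ℝ] X) w)) {A : ℝ} (hA : 0 ≤ A)
    (h : ∀ v, |q v| ≤ A * chartNorm F φ y v) : finslerDualNorm F y Δ ≤ A := by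
  refine Real.sSup_le ?_ hA
  rintro _ ⟨ξ, hξ, rfl⟩
  have h1 := h ((mfderiv 𝓘(ℝ, X) 𝓘(ℝ, X) φ y : X →L[ℝ] X) ξ)
  rw [← hq ξ] at h1
  have h2 : chartNorm F φ y ((mfderiv 𝓘(ℝ, X) 𝓘(ℝ, X) φ y : X →L[ℝ] X) ξ) = F y ξ :=
    chartNorm_mfderiv hφ hy ξ
  rwa [h2, hξ, mul_one] at h1

theorem IsViscositySubgradient.exists_contMDiff [RegularSpace M] {b : X → ℝ} {K : ℝ}
    (hb : IsNormalizedBump b K) (hφ : φ ∈ IsManifold.maximalAtlas 𝓘(ℝ, X) 1 M)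
    {f : ℝ × M → ℝ} {t : ℝ} {y : M} (hy : y ∈ φ.source) {p : ℝ × X →L[ℝ] ℝ}
    (hp : IsViscositySubgradient (fun z : ℝ × X => f (z.1, φ.symm z.2)) (t, φ y) p) :
    ∃ g : ℝ × M → ℝ, ContMDiff (𝓘(ℝ, ℝ).prod 𝓘(ℝ, X)) 𝓘(ℝ, ℝ) 1 g ∧
      IsLocalMin (fun z => f z - g z) (t, y) ∧
      ∀ w : ℝ × X, (mvfderiv (𝓘(ℝ, ℝ).prod 𝓘(ℝ, X)) g (t, y) : ℝ × X →L[ℝ] ℝ) w =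
        p (w.1, (mfderiv 𝓘(ℝ, X) 𝓘(ℝ, X) φ y : X →L[ℝ] X) w.2) := by
  obtain ⟨G, hG, hmin, rfl⟩ := hp
  obtain ⟨g, hgC, hgG⟩ := exists_contMDiff_eventuallyEq hb hφ hy t hG
  refine ⟨g, hgC, ?_, fun w => mvfderiv_chart_apply hφ hy t hG hgG w⟩
  have hcont : Tendsto (fun p : ℝ × M => (p.1, φ p.2)) (𝓝 (t, y)) (𝓝 (t, φ y)) :=
    (continuous_fst.continuousAt.prodMk (ContinuousAt.comp (x := ((t, y) : ℝ × M)) (f := Prod.snd)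
      (g := φ) (φ.continuousAt hy) continuous_snd.continuousAt)).tendsto
  have hsrc : ∀ᶠ q : ℝ × M in 𝓝 (t, y), q.2 ∈ φ.source :=
    continuous_snd.continuousAt.preimage_mem_nhds (φ.open_source.mem_nhds hy)
  filter_upwards [hcont.eventually hmin, hgG, hsrc] with q h1 h2 h3
  simp only [φ.left_inv h3, φ.left_inv hy] at h1
  rw [h2, hgG.eq_of_nhds]
  exact h1

variable [IsManifold 𝓘(ℝ, X) 1 M]

theorem abs_le_finslerDualNorm_mul (hF : IsPalaisFinsler F)
    (hφ : φ ∈ IsManifold.maximalAtlas 𝓘(ℝ, X) 1 M) {y : M}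
    (hy : y ∈ φ.source) {Δ : TangentSpace 𝓘(ℝ, X) y →L[ℝ] ℝ} {q : X →L[ℝ] ℝ}
    (hq : ∀ w : X, Δ w = q ((mfderiv 𝓘(ℝ, X) 𝓘(ℝ, X) φ y : X →L[ℝ] X) w)) (v : X) :
    |q v| ≤ finslerDualNorm F y Δ * chartNorm F φ y v := by
  obtain ⟨K, hK1, hK⟩ := hF.equivalent φ hφ y hy
  have hK0 : 0 < K := by linarith
  have hKv : ∀ v, ‖v‖ ≤ K * chartNorm F φ y v := fun v => by
    have := (hK v).1
    rwa [inv_mul_le_iff₀ hK0] at this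
  -- A real supremum of an unbounded set would be `0`; boundedness holds because Finsler unit
  -- vectors are bounded in `X`.
  have hbdd : BddAbove {r : ℝ | ∃ ξ, F y ξ = 1 ∧ r = |Δ ξ|} := by
    refine ⟨‖q‖ * K, ?_⟩
    rintro _ ⟨ξ, hξ, rfl⟩
    have h1 := hKv ((mfderiv 𝓘(ℝ, X) 𝓘(ℝ, X) φ y : X →L[ℝ] X) ξ)
    have h2 : chartNorm F φ y ((mfderiv 𝓘(ℝ, X) 𝓘(ℝ, X) φ y : X →L[ℝ] X) ξ) = F y ξ :=
      chartNorm_mfderiv hφ hy ξ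
    rw [h2, hξ, mul_one] at h1
    have h3 := q.le_opNorm ((mfderiv 𝓘(ℝ, X) 𝓘(ℝ, X) φ y : X →L[ℝ] X) ξ)
    rw [← hq ξ] at h3
    exact h3.trans (mul_le_mul_of_nonneg_left h1 (norm_nonneg _))
  set ξ : X := (mfderiv 𝓘(ℝ, X) 𝓘(ℝ, X) φ.symm (φ y) : X →L[ℝ] X) v with hξ
  have hFξ : chartNorm F φ y v = F y ξ := rfl
  have hqv : q v = Δ ξ := by rw [hq ξ, hξ, mfderiv_mfderiv_symm hφ hy]
  rcases (hF.nonneg y ξ).eq_or_lt with h0 | hpos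
  · have h1 := hKv v
    rw [hFξ, ← h0, mul_zero] at h1
    have h2 : v = 0 := norm_le_zero_iff.1 h1
    rw [hFξ, ← h0, h2]
    simp
  · have h1 : |Δ ((F y ξ)⁻¹ • ξ)| ≤ finslerDualNorm F y Δ := by
      refine le_csSup hbdd ⟨_, ?_, rfl⟩
      refine (hF.smul y _ ξ).trans ?_
      rw [abs_of_pos (inv_pos.2 hpos), inv_mul_cancel₀ hpos.ne']
    have h2 : Δ ((F y ξ)⁻¹ • ξ) = (F y ξ)⁻¹ * Δ ξ := map_smul Δ _ ξ
    rw [h2, abs_mul, abs_of_pos (inv_pos.2 hpos), inv_mul_le_iff₀ hpos] at h1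
    rw [hqv, hFξ]
    linarith

/-- The value of the dual norm at `x` of the covector represented by `q` in the chart `φ`. -/
def IsChartDualNorm (F : ∀ x : M, TangentSpace 𝓘(ℝ, X) x → ℝ) (φ : OpenPartialHomeomorph M X)
    (x : M) (q : X → ℝ) (n : ℝ) : Prop :=
  0 ≤ n ∧ (∀ v, |q v| ≤ n * chartNorm F φ x v) ∧
    ∀ A : ℝ, 0 ≤ A → (∀ v, |q v| ≤ A * chartNorm F φ x v) → n ≤ A

theorem isChartDualNorm_finslerDualNorm (hF : IsPalaisFinsler F)
    (hφ : φ ∈ IsManifold.maximalAtlas 𝓘(ℝ, X) 1 M) {y : M}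
    (hy : y ∈ φ.source) {Δ : TangentSpace 𝓘(ℝ, X) y →L[ℝ] ℝ} {q : X →L[ℝ] ℝ}
    (hq : ∀ w : X, Δ w = q ((mfderiv 𝓘(ℝ, X) 𝓘(ℝ, X) φ y : X →L[ℝ] X) w)) :
    IsChartDualNorm F φ y q (finslerDualNorm F y Δ) :=
  ⟨finslerDualNorm_nonneg y Δ, abs_le_finslerDualNorm_mul hF hφ hy hq,
    fun _ hA h => finslerDualNorm_le hφ hy hq hA h⟩

theorem IsViscositySupersolution.exists_dualNorm [RegularSpace M] {b : X → ℝ} {K : ℝ}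
    (hb : IsNormalizedBump b K) (hF : IsPalaisFinsler F)
    (hφ : φ ∈ IsManifold.maximalAtlas 𝓘(ℝ, X) 1 M) {H : ℝ → M → ℝ → ℝ} {h : M → ℝ}
    {f : ℝ × M → ℝ} (hf : IsViscositySupersolution F H h f) {t : ℝ} (ht : 0 < t) {y : M}
    (hy : y ∈ φ.source) {p : ℝ × X →L[ℝ] ℝ}
    (hp : IsViscositySubgradient (fun z : ℝ × X => f (z.1, φ.symm z.2)) (t, φ y) p) :
    ∃ n, IsChartDualNorm F φ y (fun v => p (0, v)) n ∧ 0 ≤ p (1, 0) + H t y n := by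
  obtain ⟨g, hgC, hmin, hd⟩ := hp.exists_contMDiff hb hφ hy
  have hmem : mvfderiv (𝓘(ℝ, ℝ).prod 𝓘(ℝ, X)) g (t, y) ∈
      subdifferential (𝓘(ℝ, ℝ).prod 𝓘(ℝ, X)) (Ioi 0 ×ˢ univ) f (t, y) :=
    ⟨g, hgC.contMDiffOn, hmin, rfl⟩
  refine ⟨_, isChartDualNorm_finslerDualNorm hF hφ hy
    (Δ := spacePart (mvfderiv (𝓘(ℝ, ℝ).prod 𝓘(ℝ, X)) g (t, y)))
    (q := p ∘L ContinuousLinearMap.inr ℝ ℝ X) fun w => hd (0, w), ?_⟩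
  have h1 := hf.ineq t ht y _ hmem
  have h2 : timePart (mvfderiv (𝓘(ℝ, ℝ).prod 𝓘(ℝ, X)) g (t, y)) = p (1, 0) := by
    exact (hd (1, 0)).trans (congrArg (fun z => p (1, z))
      (map_zero (mfderiv 𝓘(ℝ, X) 𝓘(ℝ, X) φ y : X →L[ℝ] X)))
  rwa [h2] at h1

/-- A subgradient `p` of `-f` gives the superdifferential element `-p` of `f`. Dual norms are even,
so only the time component keeps the sign. -/
theorem IsViscositySubsolution.exists_dualNorm [RegularSpace M] {b : X → ℝ} {K : ℝ}
    (hb : IsNormalizedBump b K) (hF : IsPalaisFinsler F)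
    (hφ : φ ∈ IsManifold.maximalAtlas 𝓘(ℝ, X) 1 M) {H : ℝ → M → ℝ → ℝ} {h : M → ℝ}
    {f : ℝ × M → ℝ} (hf : IsViscositySubsolution F H h f) {t : ℝ} (ht : 0 < t) {y : M}
    (hy : y ∈ φ.source) {p : ℝ × X →L[ℝ] ℝ}
    (hp : IsViscositySubgradient (fun z : ℝ × X => -f (z.1, φ.symm z.2)) (t, φ y) p) :
    ∃ n, IsChartDualNorm F φ y (fun v => p (0, v)) n ∧ -p (1, 0) + H t y n ≤ 0 := by
  obtain ⟨g, hgC, hmin, hd⟩ := IsViscositySubgradient.exists_contMDiff (f := fun z => -f z)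
    hb hφ hy hp
  have hmem : mvfderiv (𝓘(ℝ, ℝ).prod 𝓘(ℝ, X)) (fun z => -g z) (t, y) ∈
      superdifferential (𝓘(ℝ, ℝ).prod 𝓘(ℝ, X)) (Ioi 0 ×ˢ univ) f (t, y) := by
    refine ⟨fun z => -g z, hgC.neg.contMDiffOn, ?_, rfl⟩
    filter_upwards [hmin] with z hz
    linarith
  have hneg : ∀ w : ℝ × X,
      (mvfderiv (𝓘(ℝ, ℝ).prod 𝓘(ℝ, X)) (fun z => -g z) (t, y) : ℝ × X →L[ℝ] ℝ) w =
        (-p) (w.1, (mfderiv 𝓘(ℝ, X) 𝓘(ℝ, X) φ y : X →L[ℝ] X) w.2) := by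
    intro w
    have h1 : mvfderiv (𝓘(ℝ, ℝ).prod 𝓘(ℝ, X)) (fun z => -g z) (t, y)
      = -mvfderiv (𝓘(ℝ, ℝ).prod 𝓘(ℝ, X)) g (t, y) := mvfderiv_neg
    rw [h1]
    exact congrArg Neg.neg (hd w)
  obtain ⟨n0, n1, n2⟩ := isChartDualNorm_finslerDualNorm hF hφ hy
    (Δ := spacePart (mvfderiv (𝓘(ℝ, ℝ).prod 𝓘(ℝ, X)) (fun z => -g z) (t, y)))
    (q := -(p ∘L ContinuousLinearMap.inr ℝ ℝ X)) fun w => hneg (0, w)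
  refine ⟨_, ⟨n0, fun v => ?_, fun A hA hv => n2 A hA fun v => ?_⟩, ?_⟩
  · simpa using n1 v
  · simpa using hv v
  have h1 := hf.ineq t ht y _ hmem
  have h2 : timePart (mvfderiv (𝓘(ℝ, ℝ).prod 𝓘(ℝ, X)) (fun z => -g z) (t, y)) = -p (1, 0) := by
    exact (hneg (1, 0)).trans (congrArg (fun z => -p (1, z))
      (map_zero (mfderiv 𝓘(ℝ, X) 𝓘(ℝ, X) φ y : X →L[ℝ] X)))
  rwa [h2] at h1

end ChartTransfer

/-! ### The comparison principle -/

section Comparison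

variable {X : Type*} [NormedAddCommGroup X] [NormedSpace ℝ X]
  {M : Type*} [TopologicalSpace M] [ChartedSpace X M]
  {F : ∀ x : M, TangentSpace 𝓘(ℝ, X) x → ℝ}

/-- Comparison of dual norms at two nearby points. -/
theorem IsChartDualNorm.sub_le {φ : OpenPartialHomeomorph M X} {N₀ : X → ℝ} {x₁ x₂ : M}
    {q₁ q₂ : X → ℝ} {n₁ n₂ η β μ : ℝ} (h₁ : IsChartDualNorm F φ x₁ q₁ n₁)
    (h₂ : IsChartDualNorm F φ x₂ q₂ n₂) (hN₀ : ∀ v, 0 ≤ N₀ v) (hη : 0 ≤ η) (hη1 : η ≤ 1)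
    (hβ : 0 ≤ β) (hμ : 0 ≤ μ)
    (hx₁ : ∀ v, N₀ v ≤ (1 + η) * chartNorm F φ x₁ v)
    (hx₂ : ∀ v, N₀ v ≤ (1 + η) * chartNorm F φ x₂ v ∧ chartNorm F φ x₂ v ≤ (1 + η) * N₀ v)
    (hq : ∀ v, |q₁ v| ≤ |q₂ v| + μ * N₀ v) (hq₂ : ∀ v, |q₂ v| ≤ β * N₀ v) :
    n₂ ≤ 2 * β ∧ n₁ - n₂ ≤ 6 * β * η + 2 * μ := by
  have hn₂ : n₂ ≤ 2 * β := by
    refine h₂.2.2 _ (by positivity) fun v => (hq₂ v).trans ?_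
    have e1 := (hx₂ v).1
    have e2 := (hx₂ v).2
    have e3 := hN₀ v
    have e4 : 0 ≤ chartNorm F φ x₂ v := by
      by_contra! hneg
      nlinarith
    have e5 : N₀ v ≤ 2 * chartNorm F φ x₂ v := by nlinarith
    nlinarith
  refine ⟨hn₂, ?_⟩
  have h0 := h₂.1
  -- The estimate passes through the reference norm `N₀`, at the cost of one factor `1 + η` at each
  -- of the two points.
  have hle : n₁ ≤ (n₂ * (1 + η) + μ) * (1 + η) := by
    refine h₁.2.2 _ (by positivity) fun v => ?_
    have e1 := h₂.2.1 v
    have e2 := mul_le_mul_of_nonneg_left (hx₂ v).2 h0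
    calc |q₁ v| ≤ (n₂ * (1 + η) + μ) * N₀ v := by linarith [hq v]
      _ ≤ (n₂ * (1 + η) + μ) * ((1 + η) * chartNorm F φ x₁ v) :=
        mul_le_mul_of_nonneg_left (hx₁ v) (by positivity)
      _ = _ := by ring
  have e1 : n₂ * ((1 + η) * (1 + η) - 1) ≤ 2 * β * (3 * η) :=
    mul_le_mul hn₂ (by nlinarith) (by nlinarith) (by positivity)
  have e2 : μ * (1 + η) ≤ μ * 2 := mul_le_mul_of_nonneg_left (by linarith) hμ
  nlinarith

variable [IsManifold 𝓘(ℝ, X) 1 M]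

/-- Ekeland's variational principle on `[0, T] × M`. -/
theorem exists_ekeland_point_strip [PreconnectedSpace M] [RegularSpace M] (hF : IsPalaisFinsler F)
    (hcomplete : IsFinslerComplete F) {T : ℝ} {G : ℝ × M → ℝ}
    (hG : LowerSemicontinuousOn G (Icc 0 T ×ˢ univ)) {m : ℝ}
    (hm : ∀ t ∈ Icc 0 T, ∀ x, m ≤ G (t, x)) {ε : ℝ} (hε : 0 < ε) {t' : ℝ} (ht' : t' ∈ Icc 0 T)
    (x' : M) :
    ∃ t₀ ∈ Icc 0 T, ∃ x₀, G (t₀, x₀) ≤ G (t', x') ∧ ∀ t ∈ Icc 0 T, ∀ x,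
      G (t₀, x₀) ≤ G (t, x) + ε * (|t - t₀| + finslerDist F x x₀) := by
  let D : (Icc 0 T ×ˢ (univ : Set M) : Set (ℝ × M)) → (Icc 0 T ×ˢ (univ : Set M) : Set (ℝ × M)) → ℝ :=
    fun p q => |p.1.1 - q.1.1| + finslerDist F p.1.2 q.1.2
  obtain ⟨⟨⟨t₀, x₀⟩, ht₀, _⟩, h1, h2⟩ := exists_ekeland_point (D := D) (G := fun p => G p.1)
    (fun p q => add_nonneg (abs_nonneg _) (finslerDist_nonneg _ _))
    (fun p => by simp [D, finslerDist_self])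
    (fun p q => by simp only [D, abs_sub_comm p.1.1, finslerDist_comm hF p.1.2])
    (fun p q r => by
      have e1 := abs_sub_le p.1.1 q.1.1 r.1.1
      have e2 := finslerDist_triangle hF p.1.2 q.1.2 r.1.2
      simp only [D]
      linarith)
    (fun p => hm p.1.1 p.2.1 p.1.2)
    (fun s hs => by
      have hc1 : CauchySeq fun n => (s n).1.1 := Metric.cauchySeq_iff.2 fun η hη => by
        obtain ⟨N, hN⟩ := hs η hη
        refine ⟨N, fun i hi j hj => ?_⟩
        have e1 : |(s i).1.1 - (s j).1.1| + finslerDist F (s i).1.2 (s j).1.2 < η := hN i hi j hj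
        rw [Real.dist_eq]
        linarith [finslerDist_nonneg (F := F) (s i).1.2 (s j).1.2]
      obtain ⟨t, ht⟩ := cauchySeq_tendsto_of_complete hc1
      have htT : t ∈ Icc 0 T := isClosed_Icc.mem_of_tendsto ht
        (Eventually.of_forall fun n => (s n).2.1)
      obtain ⟨x, hx⟩ := hcomplete (fun n => (s n).1.2) fun η hη => by
        obtain ⟨N, hN⟩ := hs η hη
        refine ⟨N, fun i hi j hj => ?_⟩
        have e1 : |(s i).1.1 - (s j).1.1| + finslerDist F (s i).1.2 (s j).1.2 < η := hN i hi j hj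
        linarith [abs_nonneg ((s i).1.1 - (s j).1.1)]
      refine ⟨⟨(t, x), htT, mem_univ _⟩, ?_, fun q hq => ?_⟩
      · have e1 : Tendsto (fun n => |(s n).1.1 - t|) atTop (𝓝 0) := by
          simpa using (ht.sub_const t).abs
        simpa [D] using e1.add hx
      -- Convergence for the Finsler distance implies convergence in `M`, so semicontinuity of `G`
      -- applies.
      · have hlim : Tendsto (fun n => (s n).1) atTop (𝓝 (t, x)) :=
          (ht.prodMk_nhds (tendsto_of_tendsto_finslerDist hF hx))
        exact (tendsto_nhdsWithin_iff.2 ⟨hlim, Eventually.of_forall fun n => (s n).2⟩).eventually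
          (hG (t, x) ⟨htT, mem_univ _⟩ q hq))
    hε ⟨(t', x'), ht', mem_univ _⟩
  exact ⟨t₀, ht₀, x₀, h1, fun t ht x => h2 ⟨(t, x), ht, mem_univ _⟩⟩

set_option maxHeartbeats 1000000 in
/-- In the space of covectors over a chart of `ℝ × M`, near a point where `v - u + Θ` has a local
minimum up to a perturbation of slope `ε`, there are points at which the sub- and supersolution
inequalities hold with almost equal covectors. -/
theorem exists_viscosity_pair [CompleteSpace X] [PreconnectedSpace M] [RegularSpace M]
    {b : X → ℝ} {Kb : ℝ} (hb : IsNormalizedBump b Kb) (hF : IsPalaisFinsler F)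
    {H₁ H₂ : ℝ → M → ℝ → ℝ} {h₁ h₂ : M → ℝ} {u v : ℝ × M → ℝ}
    (hv : IsViscositySupersolution F H₁ h₁ v) (hu : IsViscositySubsolution F H₂ h₂ u)
    {t₀ : ℝ} (ht₀ : 0 < t₀) {x₀ : M}
    (hlip : IsLipschitzNear F u (t₀, x₀) ∨ IsLipschitzNear F v (t₀, x₀))
    {Θ : ℝ → ℝ} (hΘ : ContDiff ℝ 1 Θ) {ε : ℝ} (hε : 0 < ε)
    (hmin : ∀ᶠ p : ℝ × M in 𝓝 (t₀, x₀), v (t₀, x₀) - u (t₀, x₀) + Θ t₀ ≤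
      v p - u p + Θ p.1 + ε * (|p.1 - t₀| + finslerDist F p.2 x₀))
    {δ : ℝ} (hδ : 0 < δ) :
    ∃ (t₁ t₂ : ℝ) (x₁ x₂ : M) (τ₁ τ₂ n₁ n₂ : ℝ), 0 < t₁ ∧ 0 < t₂ ∧
      0 ≤ τ₁ + H₁ t₁ x₁ n₁ ∧ τ₂ + H₂ t₂ x₂ n₂ ≤ 0 ∧ τ₁ - τ₂ ≤ δ + ε - deriv Θ t₀ ∧
      |n₁ - n₂| ≤ 4 * ε + δ ∧ max |n₁| |n₂| * (|t₁ - t₂| + finslerDist F x₁ x₂) ≤ δ ∧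
      |t₁ - t₂| ≤ δ ∧ finslerDist F x₁ x₂ ≤ δ := by
  set φ := chartAt X x₀ with hφdef
  have hφ : φ ∈ IsManifold.maximalAtlas 𝓘(ℝ, X) 1 M := IsManifold.chart_mem_maximalAtlas x₀
  have hx₀ : x₀ ∈ φ.source := mem_chart_source X x₀
  obtain ⟨K, hK1, hK⟩ := hF.equivalent φ hφ x₀ hx₀
  have hK0 : 0 < K := by linarith
  set N₀ : X → ℝ := chartNorm F φ x₀ with hN₀def
  have hN₀ : ∀ w, 0 ≤ N₀ w := fun w => hF.nonneg _ _
  have hN₀K : ∀ w, N₀ w ≤ K * ‖w‖ := fun w => (hK w).2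
  have hKN₀ : ∀ w, ‖w‖ ≤ K * N₀ w := fun w => by
    have := (hK w).1
    rwa [inv_mul_le_iff₀ hK0] at this
  -- a common neighborhood and Lipschitz constant
  obtain ⟨W, hW, L, hL, hlip'⟩ : ∃ W ∈ 𝓝 (t₀, x₀), ∃ L : ℝ, 0 ≤ L ∧
      ((∀ p ∈ W, ∀ q ∈ W, |v p - v q| ≤ L * (|p.1 - q.1| + finslerDist F p.2 q.2)) ∨
        ∀ p ∈ W, ∀ q ∈ W, |u p - u q| ≤ L * (|p.1 - q.1| + finslerDist F p.2 q.2)) := by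
    have hmax : ∀ (L : ℝ) (p q : ℝ × M), L * (|p.1 - q.1| + finslerDist F p.2 q.2) ≤
        max L 0 * (|p.1 - q.1| + finslerDist F p.2 q.2) := fun L p q =>
      mul_le_mul_of_nonneg_right (le_max_left _ _)
        (add_nonneg (abs_nonneg _) (finslerDist_nonneg _ _))
    rcases hlip with ⟨W, hW, L, h⟩ | ⟨W, hW, L, h⟩
    · exact ⟨W, hW, max L 0, le_max_right _ _,
        Or.inr fun p hp q hq => (h p hp q hq).trans (hmax L p q)⟩
    · exact ⟨W, hW, max L 0, le_max_right _ _,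
        Or.inl fun p hp q hq => (h p hp q hq).trans (hmax L p q)⟩
  set L₁ : ℝ := L * (1 + 2 * K) with hL₁
  set L₂ : ℝ := ε * (1 + 2 * K) with hL₂
  have hL₁0 : 0 ≤ L₁ := by positivity
  have hL₂0 : 0 ≤ L₂ := by positivity
  set θ : ℝ × X → ℝ := fun z => Θ z.1 with hθ
  have hθC : ContDiff ℝ 1 θ := hΘ.comp contDiff_fst
  set z₀ : ℝ × X := (t₀, φ x₀) with hz₀
  -- Bound for both covectors, fixed before the radius is chosen; the `1` absorbs the tolerance `R <
  -- δ' ≤ 1` of the sum rule.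
  set B : ℝ := L₁ + L₂ + ‖fderiv ℝ θ z₀‖ + 1 with hB
  have hB0 : 0 ≤ B := by positivity
  -- Makes the distortion term `6 * (B * K) * η` in the comparison of dual norms at most `δ / 2`.
  set η : ℝ := min 1 (δ / (12 * (B + 1) * K)) with hη
  have hη0 : 0 < η := by positivity
  have hη1 : η ≤ 1 := min_le_left _ _
  have hηδ : 12 * B * K * η ≤ δ := by
    have h1 : η ≤ δ / (12 * (B + 1) * K) := min_le_right _ _
    rw [le_div_iff₀ (by positivity)] at h1
    nlinarith [mul_pos hη0 hK0]
  set δ' : ℝ := min 1 (δ / (8 * (B + 1) * K * (1 + 2 * K))) with hδ'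
  have hδ'0 : 0 < δ' := by positivity
  have hδ'1 : δ' ≤ 1 := min_le_left _ _
  have hδ'B : 8 * (B + 1) * K * ((1 + 2 * K) * δ') ≤ δ := by
    have h1 : δ' ≤ δ / (8 * (B + 1) * K * (1 + 2 * K)) := min_le_right _ _
    rw [le_div_iff₀ (by positivity)] at h1
    linarith
  have hδ'2 : 8 * K * ((1 + 2 * K) * δ') ≤ δ := by
    have h1 : 0 ≤ B * K * ((1 + 2 * K) * δ') := by positivity
    nlinarith
  have hδ'3 : 8 * ((1 + 2 * K) * δ') ≤ δ := by
    have h1 : 0 ≤ (1 + 2 * K) * δ' := by positivity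
    nlinarith
  have hδ'4 : 8 * K * δ' ≤ δ := by
    have h1 : 0 ≤ K * (K * δ') := by positivity
    nlinarith
  have hδ'5 : 8 * δ' ≤ δ := by
    have h1 : 0 ≤ K * δ' := by positivity
    nlinarith
  -- the chart ball
  obtain ⟨A, hA, U, hU, hAU⟩ := mem_nhds_prod_iff.1
    (inter_mem (inter_mem hW hmin) (continuous_fst.continuousAt.preimage_mem_nhds
      (Ioi_mem_nhds ht₀) : Prod.fst ⁻¹' Ioi 0 ∈ 𝓝 ((t₀, x₀) : ℝ × M)))
  obtain ⟨rt, hrt, hrtA⟩ := Metric.mem_nhds_iff.1 hA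
  obtain ⟨rx, hrx, hrxt, hrxN⟩ := exists_chart_ball hF hφ hx₀ hη0 hU
  set R : ℝ := min δ' (min rt rx) / 2 with hR
  have hR0 : 0 < R := by positivity
  have hRt : R < rt := by
    have : min δ' (min rt rx) ≤ rt := (min_le_right _ _).trans (min_le_left _ _)
    rw [hR]; linarith
  have hRx : R < rx := by
    have : min δ' (min rt rx) ≤ rx := (min_le_right _ _).trans (min_le_right _ _)
    rw [hR]; linarith
  have hRδ : R < δ' := by
    have : min δ' (min rt rx) ≤ δ' := min_le_left _ _
    rw [hR]; linarith
  set Q : ℝ × X → ℝ × M := fun z => (z.1, φ.symm z.2) with hQ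
  have hQz₀ : Q z₀ = (t₀, x₀) := by simp [hQ, hz₀, φ.left_inv hx₀]
  have hb1 : ∀ z ∈ Metric.closedBall z₀ R, z.1 ∈ Metric.ball t₀ rt := fun z hz => by
    have h1 : dist z.1 t₀ ≤ dist z z₀ := le_max_left _ _
    exact (h1.trans hz).trans_lt hRt
  have hb2 : ∀ z ∈ Metric.closedBall z₀ R, z.2 ∈ Metric.ball (φ x₀) rx := fun z hz => by
    have h1 : dist z.2 (φ x₀) ≤ dist z z₀ := le_max_right _ _
    exact (h1.trans hz).trans_lt hRx
  have hmem : ∀ z ∈ Metric.closedBall z₀ R, (Q z ∈ W ∧ v (t₀, x₀) - u (t₀, x₀) + Θ t₀ ≤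
      v (Q z) - u (Q z) + Θ z.1 + ε * (|z.1 - t₀| + finslerDist F (φ.symm z.2) x₀)) ∧ 0 < z.1 :=
    fun z hz => hAU (mk_mem_prod (hrtA (hb1 z hz)) (hrxN _ (hb2 z hz)).1)
  have hd : ∀ ξ ∈ Metric.ball (φ x₀) rx, ∀ ξ' ∈ Metric.ball (φ x₀) rx,
      finslerDist F (φ.symm ξ) (φ.symm ξ') ≤ (1 + η) * N₀ (ξ' - ξ) := fun ξ hξ ξ' hξ' =>
    finslerDist_symm_le hφ hrxt (N := fun w => (1 + η) * N₀ w)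
      (fun w => mul_nonneg (by positivity) (hN₀ w)) (fun ζ hζ w => ((hrxN ζ hζ).2 w).2) hξ hξ'
  have hd2 : ∀ z ∈ Metric.closedBall z₀ R, ∀ z' ∈ Metric.closedBall z₀ R,
      |z.1 - z'.1| + finslerDist F (φ.symm z.2) (φ.symm z'.2) ≤ (1 + 2 * K) * ‖z - z'‖ := by
    intro z hz z' hz'
    have e1 := hd _ (hb2 z hz) _ (hb2 z' hz')
    have e2 := hN₀K (z'.2 - z.2)
    have e3 : ‖z'.2 - z.2‖ ≤ ‖z - z'‖ := by rw [norm_sub_rev]; exact le_max_right _ _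
    have e4 : |z.1 - z'.1| ≤ ‖z - z'‖ := le_max_left _ _
    have e5 := mul_le_mul_of_nonneg_left e3 hK0.le
    have e6 : (1 + η) * N₀ (z'.2 - z.2) ≤ 2 * N₀ (z'.2 - z.2) :=
      mul_le_mul_of_nonneg_right (by linarith) (hN₀ _)
    linarith
  have hQc : ContinuousOn Q (Metric.closedBall z₀ R) := by
    refine continuousOn_fst.prodMk ?_
    exact φ.continuousOn_symm.comp continuousOn_snd fun z hz => hrxt (hb2 z hz)
  have hQmaps : MapsTo Q (Metric.closedBall z₀ R) (Ici 0 ×ˢ univ) := fun z hz =>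
    ⟨(hmem z hz).2.le, mem_univ _⟩
  have hvlsc : LowerSemicontinuousOn (fun z => v (Q z)) (Metric.closedBall z₀ R) :=
    hv.lsc.comp hQc hQmaps
  have hulsc : LowerSemicontinuousOn (fun z => -u (Q z)) (Metric.closedBall z₀ R) :=
    (hu.usc.comp hQc hQmaps).neg
  set l : ℝ × X → ℝ := fun z => ε * (|z.1 - t₀| + finslerDist F (φ.symm z.2) x₀) with hl
  have hldiff : ∀ z z' : ℝ × X, l z - l z' ≤
      ε * (|z.1 - z'.1| + finslerDist F (φ.symm z.2) (φ.symm z'.2)) := by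
    intro z z'
    have e1 := finslerDist_triangle hF (φ.symm z.2) (φ.symm z'.2) x₀
    have e2 := abs_sub_le z.1 z'.1 t₀
    simp only [hl]
    nlinarith
  have hlL : ∀ z ∈ Metric.closedBall z₀ R, ∀ z' ∈ Metric.closedBall z₀ R,
      |l z - l z'| ≤ L₂ * ‖z - z'‖ := by
    intro z hz z' hz'
    have e1 := (hldiff z z').trans (mul_le_mul_of_nonneg_left (hd2 z hz z' hz') hε.le)
    have e2 := (hldiff z' z).trans (mul_le_mul_of_nonneg_left (hd2 z' hz' z hz) hε.le)
    rw [norm_sub_rev z' z] at e2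
    rw [abs_le, hL₂]
    constructor <;> linarith
  have hlip₁ : (∀ z ∈ Metric.closedBall z₀ R, ∀ z' ∈ Metric.closedBall z₀ R,
      |v (Q z) - v (Q z')| ≤ L₁ * ‖z - z'‖) ∨ ∀ z ∈ Metric.closedBall z₀ R,
      ∀ z' ∈ Metric.closedBall z₀ R, |-u (Q z) - -u (Q z')| ≤ L₁ * ‖z - z'‖ := by
    have e1 : ∀ z ∈ Metric.closedBall z₀ R, ∀ z' ∈ Metric.closedBall z₀ R,
        L * (|z.1 - z'.1| + finslerDist F (φ.symm z.2) (φ.symm z'.2)) ≤ L₁ * ‖z - z'‖ := by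
      intro z hz z' hz'
      rw [hL₁, mul_assoc]
      exact mul_le_mul_of_nonneg_left (hd2 z hz z' hz') hL
    rcases hlip' with h | h
    · exact Or.inl fun z hz z' hz' => (h _ (hmem z hz).1.1 _ (hmem z' hz').1.1).trans (e1 z hz z' hz')
    · refine Or.inr fun z hz z' hz' => ?_
      rw [neg_sub_neg, abs_sub_comm]
      exact (h _ (hmem z hz).1.1 _ (hmem z' hz').1.1).trans (e1 z hz z' hz')
  obtain ⟨bE, KE, hbE⟩ := exists_isNormalizedBump_real
  obtain ⟨z₁, hz₁, z₂, hz₂, z₃, hz₃, p₁, p₂, p₃, hp₁, hp₂, hp₃, hsum, hn₁, hn₂⟩ :=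
    exists_isViscositySubgradient_add_add (hbE.prod hb) hR0 hL₁0 hL₂0 hvlsc hulsc hlip₁ hlL hθC
      (fun z hz => by
        have e1 := (hmem z hz).1.2
        have e2 : l z₀ = 0 := by simp [hl, hz₀, φ.left_inv hx₀, finslerDist_self]
        rw [hQz₀, e2]
        simp only [hθ, hl, hz₀]
        linarith) (δ := R) hR0
  replace hz₁ := Metric.ball_subset_closedBall hz₁
  replace hz₂ := Metric.ball_subset_closedBall hz₂
  replace hn₁ : ‖p₁‖ ≤ B := by linarith
  replace hn₂ : ‖p₂‖ ≤ B := by linarith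
  replace hsum := hsum.trans hRδ.le
  -- the covector of the perturbation
  have hp₃le : ∀ w : ℝ × X, p₃ w ≤ ε * (|w.1| + (1 + η) * N₀ w.2) := by
    intro w
    refine hp₃.apply_le ?_
    have hc : Tendsto (fun s : ℝ => z₃ + s • w) (𝓝[>] 0) (𝓝 z₃) := by
      have : ContinuousAt (fun s : ℝ => z₃ + s • w) 0 := by fun_prop
      simpa [ContinuousAt] using this.tendsto.mono_left (nhdsWithin_le_nhds (s := Ioi 0))
    filter_upwards [hc.eventually (Metric.isOpen_ball.mem_nhds hz₃), self_mem_nhdsWithin]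
      with s hs hs0
    have hs0' : 0 ≤ s := le_of_lt hs0
    have e1 := hldiff (z₃ + s • w) z₃
    have e2 := hd _ (hb2 _ (Metric.ball_subset_closedBall hs)) _
      (hb2 _ (Metric.ball_subset_closedBall hz₃))
    have e3 : z₃.2 - (z₃ + s • w).2 = (-s) • w.2 := by simp
    have e4 : N₀ ((-s) • w.2) = s * N₀ w.2 := by
      have h1 : N₀ ((-s) • w.2) = |-s| * N₀ w.2 :=
        (congrArg (F x₀) (map_smul (mfderiv 𝓘(ℝ, X) 𝓘(ℝ, X) φ.symm (φ x₀) : X →L[ℝ] X)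
          (-s) w.2)).trans (hF.smul x₀ (-s) _)
      rw [h1, abs_neg, abs_of_nonneg hs0']
    have e5 : (z₃ + s • w).1 - z₃.1 = s * w.1 := by simp
    rw [e3, e4] at e2
    rw [e5, abs_mul, abs_of_nonneg hs0'] at e1
    have e6 := mul_le_mul_of_nonneg_left e2 hε.le
    linarith
  have hθ' : ∀ w : ℝ × X, fderiv ℝ θ z₀ w = deriv Θ t₀ * w.1 := by
    intro w
    have h1 : HasFDerivAt θ (fderiv ℝ Θ t₀ ∘L ContinuousLinearMap.fst ℝ ℝ X) z₀ :=
      HasFDerivAt.comp z₀ (f := Prod.fst) (g := Θ)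
        (hΘ.differentiable one_ne_zero t₀).hasFDerivAt hasFDerivAt_fst
    rw [h1.fderiv, ContinuousLinearMap.comp_apply, ContinuousLinearMap.coe_fst']
    have h2 := (fderiv ℝ Θ t₀).map_smul w.1 1
    rw [smul_eq_mul, mul_one, smul_eq_mul] at h2
    rw [h2, mul_comm]
    rfl
  have hsumw : ∀ w : ℝ × X, |p₁ w + p₂ w + p₃ w + deriv Θ t₀ * w.1| ≤ δ' * ‖w‖ := by
    intro w
    have := (p₁ + p₂ + p₃ + fderiv ℝ θ z₀).le_of_opNorm_le hsum w
    simpa [hθ'] using this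
  have hpneg : ∀ (p : ℝ × X →L[ℝ] ℝ) (w : X), |p (0, w)| = |p (0, -w)| := by
    intro p w
    rw [show ((0, -w) : ℝ × X) = -(0, w) by simp, map_neg, abs_neg]
  -- Measured in the Finsler norm at `x₀`, the slope of the perturbation is a multiple of `ε` free
  -- of `K`. This is what allows `4 * ε` in the conclusion whatever the chart.
  have hp₃abs : ∀ w : X, |p₃ (0, w)| ≤ 2 * ε * N₀ w := by
    intro w
    have e1 := hp₃le (0, w)
    have e2 := hp₃le (0, -w)
    have e3 : N₀ (-w) = N₀ w := by
      have h1 : N₀ ((-1 : ℝ) • w) = |-1| * N₀ w :=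
        (congrArg (F x₀) (map_smul (mfderiv 𝓘(ℝ, X) 𝓘(ℝ, X) φ.symm (φ x₀) : X →L[ℝ] X)
          (-1 : ℝ) w)).trans (hF.smul x₀ (-1) _)
      simpa using h1
    rw [show ((0, -w) : ℝ × X) = -(0, w) by simp, map_neg] at e2
    simp only [Prod.snd_neg, Prod.fst_neg, neg_zero, abs_zero, zero_add, e3] at e1 e2
    have e4 : ε * ((1 + η) * N₀ w) ≤ 2 * ε * N₀ w := by
      have := mul_nonneg hε.le (hN₀ w)
      nlinarith
    rw [abs_le]
    constructor <;> linarith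
  have hdiff : ∀ w : X, |p₁ (0, w) + p₂ (0, w)| ≤ (2 * ε + K * δ') * N₀ w := by
    intro w
    have e1 := hsumw (0, w)
    have e2 : ‖((0, w) : ℝ × X)‖ = ‖w‖ := by simp [Prod.norm_def]
    rw [e2, mul_zero, add_zero] at e1
    have e3 := mul_le_mul_of_nonneg_left (hKN₀ w) hδ'0.le
    have e4 := abs_sub (p₁ (0, w) + p₂ (0, w) + p₃ (0, w)) (p₃ (0, w))
    rw [add_sub_cancel_right] at e4
    have := hp₃abs w
    nlinarith
  have hpB : ∀ p : ℝ × X →L[ℝ] ℝ, ‖p‖ ≤ B → ∀ w : X, |p (0, w)| ≤ B * K * N₀ w := by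
    intro p hp w
    have e1 := p.le_of_opNorm_le hp (0, w)
    have e2 : ‖((0, w) : ℝ × X)‖ = ‖w‖ := by simp [Prod.norm_def]
    rw [e2, Real.norm_eq_abs] at e1
    have e3 := mul_le_mul_of_nonneg_left (hKN₀ w) hB0
    linarith
  -- back to the manifold
  have hsrc : ∀ z ∈ Metric.closedBall z₀ R, φ.symm z.2 ∈ φ.source ∧ φ (φ.symm z.2) = z.2 :=
    fun z hz => ⟨φ.map_target (hrxt (hb2 z hz)), φ.right_inv (hrxt (hb2 z hz))⟩
  obtain ⟨n₁, hdn₁, hsup⟩ := hv.exists_dualNorm hb hF hφ (hmem z₁ hz₁).2 (hsrc z₁ hz₁).1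
    (p := p₁) (by rw [(hsrc z₁ hz₁).2]; exact hp₁)
  obtain ⟨n₂, hdn₂, hsub⟩ := hu.exists_dualNorm hb hF hφ (hmem z₂ hz₂).2 (hsrc z₂ hz₂).1
    (p := p₂) (by rw [(hsrc z₂ hz₂).2]; exact hp₂)
  have hcomp : ∀ z ∈ Metric.closedBall z₀ R, ∀ w,
      N₀ w ≤ (1 + η) * chartNorm F φ (φ.symm z.2) w ∧
        chartNorm F φ (φ.symm z.2) w ≤ (1 + η) * N₀ w := by
    intro z hz w
    obtain ⟨e1, e2⟩ := (hrxN _ (hb2 z hz)).2 w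
    rw [inv_mul_le_iff₀ (by positivity)] at e1
    exact ⟨e1, e2⟩
  have hμ : 0 ≤ 2 * ε + K * δ' := by positivity
  obtain ⟨hn₂B, hn₁₂⟩ := hdn₁.sub_le hdn₂ hN₀ hη0.le hη1 (mul_nonneg hB0 hK0.le) hμ
    (fun w => (hcomp z₁ hz₁ w).1) (hcomp z₂ hz₂)
    (fun w => by
      have e1 := abs_sub (p₁ (0, w) + p₂ (0, w)) (p₂ (0, w))
      rw [add_sub_cancel_right] at e1
      linarith [hdiff w]) (hpB p₂ hn₂)
  obtain ⟨hn₁B, hn₂₁⟩ := hdn₂.sub_le hdn₁ hN₀ hη0.le hη1 (mul_nonneg hB0 hK0.le) hμ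
    (fun w => (hcomp z₂ hz₂ w).1) (hcomp z₁ hz₁)
    (fun w => by
      have e1 := abs_sub (p₁ (0, w) + p₂ (0, w)) (p₁ (0, w))
      rw [add_sub_cancel_left] at e1
      linarith [hdiff w]) (hpB p₁ hn₁)
  have hz₁₂ : ‖z₁ - z₂‖ ≤ 2 * δ' := by
    have e1 := dist_triangle_right z₁ z₂ z₀
    rw [dist_eq_norm] at e1
    have e2 : dist z₁ z₀ ≤ R := hz₁
    have e3 : dist z₂ z₀ ≤ R := hz₂
    linarith
  have hdist := hd2 z₁ hz₁ z₂ hz₂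
  have hdist' : |z₁.1 - z₂.1| + finslerDist F (φ.symm z₁.2) (φ.symm z₂.2)
      ≤ 2 * ((1 + 2 * K) * δ') := by
    have := mul_le_mul_of_nonneg_left hz₁₂ (by positivity : 0 ≤ 1 + 2 * K)
    linarith
  have ha := abs_nonneg (z₁.1 - z₂.1)
  have hdn := finslerDist_nonneg (F := F) (φ.symm z₁.2) (φ.symm z₂.2)
  refine ⟨z₁.1, z₂.1, φ.symm z₁.2, φ.symm z₂.2, p₁ (1, 0), -p₂ (1, 0), n₁, n₂, (hmem z₁ hz₁).2,
    (hmem z₂ hz₂).2, hsup, hsub, ?_, ?_, ?_, by linarith, by linarith⟩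
  -- The approximate identity for the sum of covectors is tested on the time direction, where the
  -- perturbation contributes at most `ε`.
  · have e1 := (abs_le.1 (hsumw (1, 0))).2
    have e2 : ‖((1, 0) : ℝ × X)‖ = 1 := by simp [Prod.norm_def]
    have e3 := hp₃le (-1, 0)
    have e4 : N₀ 0 = 0 := le_antisymm (by simpa using hN₀K 0) (hN₀ 0)
    rw [show ((-1, 0) : ℝ × X) = -(1, 0) by simp, map_neg] at e3
    simp only [Prod.fst_neg, Prod.snd_neg, neg_zero, e4, abs_neg, abs_one, mul_zero, add_zero,
      mul_one] at e3
    rw [e2] at e1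
    simp only [mul_one] at e1
    linarith
  · rw [abs_le]
    constructor <;> linarith
  · rw [abs_of_nonneg hdn₁.1, abs_of_nonneg hdn₂.1]
    have e1 : max n₁ n₂ ≤ 2 * (B * K) := max_le hn₁B hn₂B
    calc _ ≤ 2 * (B * K) * (2 * ((1 + 2 * K) * δ')) :=
          mul_le_mul e1 hdist' (by positivity) (by positivity)
      _ ≤ δ := by
        have h1 : 0 ≤ K * ((1 + 2 * K) * δ') := by positivity
        have h2 : 0 ≤ B * (K * ((1 + 2 * K) * δ')) := by positivity
        nlinarith

/-- **Comparison principle.** -/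
theorem sub_le_of_initial_sub_le [CompleteSpace X] [PreconnectedSpace M] [RegularSpace M]
    {b : X → ℝ} {Kb : ℝ} (hb : IsNormalizedBump b Kb) (hF : IsPalaisFinsler F)
    (hcomplete : IsFinslerComplete F)
    {H₁ H₂ : ℝ → M → ℝ → ℝ} (hH₁ : ConditionA F H₁)
    (hH : ∀ t : ℝ, 0 ≤ t → ∀ (x : M) (r : ℝ), H₁ t x r ≤ H₂ t x r)
    {h₁ h₂ : M → ℝ} {u v : ℝ × M → ℝ}
    (hv : IsViscositySupersolution F H₁ h₁ v) (hu : IsViscositySubsolution F H₂ h₂ u)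
    (hubdd : IsBoundedOnStrips u) (hvbdd : IsBoundedOnStrips v)
    (hlip : ∀ t : ℝ, 0 < t → ∀ x : M, IsLipschitzNear F u (t, x) ∨ IsLipschitzNear F v (t, x))
    {μ : ℝ} (hμ : ∀ x, h₂ x - h₁ x ≤ μ) {t : ℝ} (ht : 0 ≤ t) (x : M) :
    u (t, x) - v (t, x) ≤ μ := by
  by_contra! hlt
  have htpos : 0 < t := by
    rcases ht.eq_or_lt with rfl | h
    · linarith [hμ x, hu.initial x, hv.initial x]
    · exact h
  set g : ℝ := u (t, x) - v (t, x) - μ with hg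
  have hg0 : 0 < g := by linarith
  -- Chosen so that `Θ t = lam * t + lam = g / 2`, half of the gap.
  set lam : ℝ := g / (2 * (t + 1)) with hlam
  have hlam0 : 0 < lam := by positivity
  have hlamg : lam * t + lam = g / 2 := by rw [hlam]; field_simp
  obtain ⟨Ku, hKu⟩ := hubdd (3 * t) (by positivity)
  obtain ⟨Kv, hKv⟩ := hvbdd (3 * t) (by positivity)
  have hw : ∀ s ∈ Icc 0 (2 * t), ∀ y, |v (s, y) - u (s, y)| ≤ Ku + Kv := fun s hs y => by
    have e1 := hKu s hs.1 (by linarith [hs.2]) y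
    have e2 := hKv s hs.1 (by linarith [hs.2]) y
    linarith [abs_sub (v (s, y)) (u (s, y))]
  -- The power `(s / t) ^ (k + 1)` equals `1` at time `t` but at `2 * t` exceeds the oscillation of
  -- `v - u`. It acts as a barrier at the final time while `Θ` stays `C¹` on all of `ℝ`.
  obtain ⟨k, hk⟩ := pow_unbounded_of_one_lt ((2 * (Ku + Kv) + g) / lam) (one_lt_two (α := ℝ))
  rw [div_lt_iff₀ hlam0] at hk
  set Θ : ℝ → ℝ := fun s => lam * s + lam * (s / t) ^ (k + 1) with hΘ
  have hΘC : ContDiff ℝ 1 Θ := by fun_prop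
  have hΘ' : ∀ s, 0 ≤ s → lam ≤ deriv Θ s := by
    intro s hs
    have h1 : HasDerivAt Θ (lam * 1 + lam * (((k + 1 : ℕ) : ℝ) * (s / t) ^ k * (1 / t))) s :=
      ((hasDerivAt_id s).const_mul lam).add
        ((((hasDerivAt_id s).div_const t).fun_pow (k + 1)).const_mul lam)
    rw [h1.deriv]
    have : 0 ≤ lam * (((k + 1 : ℕ) : ℝ) * (s / t) ^ k * (1 / t)) := by positivity
    linarith
  have hΘ0 : ∀ s, 0 ≤ s → 0 ≤ Θ s := fun s hs => by positivity
  obtain ⟨C, m, hC, hmc, hm0, hA⟩ := hH₁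
  obtain ⟨ρ, hρ, hmρ⟩ := Metric.continuousOn_iff.1 hmc (0, 0, 0) ⟨self_mem_Ici, mem_univ _⟩ (lam / 4)
    (by positivity)
  -- With `δ` below, `4 * ε + δ ≤ ρ / 2` keeps the argument of the modulus in the region where it is
  -- below `lam / 4`. The total error is then below `lam / 8 + lam / 8 + lam / 4 + lam / 8 < lam`.
  set ε : ℝ := min (lam / 8) (ρ / 16) with hε
  have hε0 : 0 < ε := by positivity
  have hε1 : ε ≤ lam / 8 := min_le_left _ _
  have hε2 : ε ≤ ρ / 16 := min_le_right _ _
  set δ : ℝ := min (lam / 8) (min (ρ / 4) (lam / (8 * (C + 1)))) with hδ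
  have hδ0 : 0 < δ := by positivity
  have hδ1 : δ ≤ lam / 8 := min_le_left _ _
  have hδ2 : δ ≤ ρ / 4 := (min_le_right _ _).trans (min_le_left _ _)
  have hδ3 : C * δ ≤ lam / 8 := by
    have h1 : δ ≤ lam / (8 * (C + 1)) := (min_le_right _ _).trans (min_le_right _ _)
    rw [le_div_iff₀ (by positivity)] at h1
    linarith
  have hsub : Icc 0 (2 * t) ×ˢ (univ : Set M) ⊆ Ici 0 ×ˢ univ :=
    prod_mono Icc_subset_Ici_self Subset.rfl
  have hGlsc : LowerSemicontinuousOn (fun p : ℝ × M => v p + -u p + Θ p.1)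
      (Icc 0 (2 * t) ×ˢ univ) :=
    ((hv.lsc.mono hsub).add (hu.usc.mono hsub).neg).add
      (hΘC.continuous.comp continuous_fst).continuousOn.lowerSemicontinuousOn
  have htI : t ∈ Icc 0 (2 * t) := ⟨ht, by linarith⟩
  obtain ⟨t₀, ht₀, x₀, hle, hek⟩ := exists_ekeland_point_strip hF hcomplete hGlsc
    (m := -(Ku + Kv)) (fun s hs y => by
      have e1 := (abs_le.1 (hw s hs y)).1
      have e2 := hΘ0 s hs.1
      simp only
      linarith) hε0 htI x
  have hval : v (t, x) + -u (t, x) + Θ t = -μ - g / 2 := by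
    simp only [hΘ, div_self htpos.ne', one_pow, mul_one]
    linarith
  simp only [hval] at hle
  -- At time `0` the initial conditions give `v - u ≥ -μ`, above the value `-μ - g / 2` reached at
  -- `(t, x)`.
  have ht₀0 : 0 < t₀ := by
    rcases ht₀.1.eq_or_lt with h0 | h
    · subst h0
      have e1 : Θ 0 = 0 := by simp [hΘ]
      rw [e1] at hle
      linarith [hμ x₀, hu.initial x₀, hv.initial x₀]
    · exact h
  have ht₀t : t₀ < 2 * t := by
    rcases ht₀.2.eq_or_lt with h0 | h
    · subst h0
      have e1 : Θ (2 * t) = lam * (2 * t) + lam * 2 ^ k * 2 := by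
        simp only [hΘ, mul_div_assoc, div_self htpos.ne', mul_one]
        ring
      have e2 := (abs_le.1 (hw _ ht₀ x₀)).1
      have e3 := (abs_le.1 (hw t htI x)).2
      have e4 : 0 < lam * (2 * t) := by positivity
      have e5 : 0 < lam * 2 ^ k := by positivity
      rw [e1] at hle
      linarith
    · exact h
  obtain ⟨t₁, t₂, x₁, x₂, τ₁, τ₂, n₁, n₂, ht₁, ht₂, hsup, hsubs, hτ, hn, hmax, htt, hxx⟩ :=
    exists_viscosity_pair hb hF hv hu ht₀0 (hlip t₀ ht₀0 x₀) hΘC hε0 (by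
      have hnh : ∀ᶠ p : ℝ × M in 𝓝 (t₀, x₀), p.1 ∈ Icc 0 (2 * t) :=
        continuous_fst.continuousAt.preimage_mem_nhds (Icc_mem_nhds ht₀0 ht₀t)
      filter_upwards [hnh] with p hp
      have := hek p.1 hp p.2
      simp only [← sub_eq_add_neg] at this
      exact this) hδ0
  have e1 := hA t₁ t₂ ht₁.le ht₂.le x₁ x₂ n₁ n₂
  have e2 : m (|t₁ - t₂|, finslerDist F x₁ x₂, n₁ - n₂) < lam / 4 := by
    have hmem : ((|t₁ - t₂|, finslerDist F x₁ x₂, n₁ - n₂) : ℝ × ℝ × ℝ) ∈ Ici (0 : ℝ) ×ˢ univ :=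
      ⟨mem_Ici.2 (abs_nonneg _), mem_univ _⟩
    have hdist := hmρ _ hmem (by
      simp only [Prod.dist_eq, Real.dist_eq, sub_zero, abs_abs]
      rw [abs_of_nonneg (finslerDist_nonneg _ _)]
      exact max_lt (by linarith) (max_lt (by linarith) (by linarith)))
    rw [hm0, Real.dist_eq, sub_zero] at hdist
    exact (le_abs_self _).trans_lt hdist
  have e3 : C * max |n₁| |n₂| * (|t₁ - t₂| + finslerDist F x₁ x₂) ≤ C * δ := by
    rw [mul_assoc]
    exact mul_le_mul_of_nonneg_left hmax hC
  have e4 := (abs_le.1 e1).2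
  have e5 := hH t₂ ht₂.le x₂ n₂
  have e6 := hΘ' t₀ ht₀0.le
  linarith

end Comparison

theorem mainTheorem11
    {X : Type*} [NormedAddCommGroup X] [NormedSpace ℝ X] [CompleteSpace X]
    (hbump : HasC1LipschitzBump X)
    {M : Type*} [TopologicalSpace M] [T2Space M] [ParacompactSpace M] [ConnectedSpace M]
    [ChartedSpace X M] [IsManifold 𝓘(ℝ, X) 1 M]
    (F : ∀ x : M, TangentSpace 𝓘(ℝ, X) x → ℝ) (hF : IsPalaisFinsler F)
    (hcomplete : IsFinslerComplete F)
    (H₁ H₂ : ℝ → M → ℝ → ℝ)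
    (hH₁cont : IsContinuousHamiltonian H₁) (hH₂cont : IsContinuousHamiltonian H₂)
    (hH₁ : ConditionA F H₁) (hH₂ : ConditionA F H₂)
    (hH : ∀ t : ℝ, 0 ≤ t → ∀ (x : M) (r : ℝ), H₁ t x r ≤ H₂ t x r)
    (h₁ h₂ : M → ℝ) (hh₁cont : Continuous h₁) (hh₂cont : Continuous h₂)
    (hh₁bdd : ∃ K : ℝ, ∀ x, |h₁ x| ≤ K) (hh₂bdd : ∃ K : ℝ, ∀ x, |h₂ x| ≤ K)
    (hh : ∀ x, h₂ x ≤ h₁ x)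
    (u v : ℝ × M → ℝ)
    (hv : IsViscositySupersolution F H₁ h₁ v) (hu : IsViscositySubsolution F H₂ h₂ u)
    (hubdd : IsBoundedOnStrips u) (hvbdd : IsBoundedOnStrips v)
    (hlip : ∀ t : ℝ, 0 < t → ∀ x : M, IsLipschitzNear F u (t, x) ∨ IsLipschitzNear F v (t, x)) :
    (⨆ (t : ℝ) (_ : 0 ≤ t) (x : M), ((u (t, x) - v (t, x) : ℝ) : EReal)) ≤
      (⨆ (t : ℝ) (_ : 0 ≤ t) (x : M) (r : ℝ), ((H₂ t x r - H₁ t x r : ℝ) : EReal)) +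
        ⨆ x : M, ((h₂ x - h₁ x : ℝ) : EReal) := by
  obtain ⟨b, K, hb⟩ := hbump.exists_isNormalizedBump
  have hle : (⨆ (t : ℝ) (_ : 0 ≤ t) (x : M), ((u (t, x) - v (t, x) : ℝ) : EReal)) ≤
      ⨆ x : M, ((h₂ x - h₁ x : ℝ) : EReal) := by
    refine iSup_le fun t => iSup_le fun ht => iSup_le fun x => ?_
    by_contra! hlt
    -- A real number strictly between the two extended values reduces the claim to a finite bound on
    -- `h₂ - h₁`.
    obtain ⟨μ, hμ₁, hμ₂⟩ := EReal.lt_iff_exists_real_btwn.1 hlt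
    have hμ : ∀ y, h₂ y - h₁ y ≤ μ := fun y =>
      EReal.coe_le_coe_iff.1 ((le_iSup (fun y => ((h₂ y - h₁ y : ℝ) : EReal)) y).trans hμ₁.le)
    have := sub_le_of_initial_sub_le hb hF hcomplete hH₁ hH hv hu hubdd hvbdd hlip hμ ht x
    exact absurd (EReal.coe_lt_coe_iff.1 hμ₂) (not_lt.2 this)
  have hnonneg : (0 : EReal) ≤
      ⨆ (t : ℝ) (_ : 0 ≤ t) (x : M) (r : ℝ), ((H₂ t x r - H₁ t x r : ℝ) : EReal) := by
    obtain ⟨x⟩ : Nonempty M := inferInstance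
    refine le_iSup_of_le 0 (le_iSup_of_le le_rfl (le_iSup_of_le x (le_iSup_of_le 0 ?_)))
    exact EReal.coe_nonneg.2 (sub_nonneg.2 (hH 0 le_rfl x 0))
  calc _ ≤ _ := hle
    _ = 0 + _ := (zero_add _).symm
    _ ≤ _ := add_le_add_left hnonneg _
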